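/- For a real number $\xi$ and a positive integer $n$, let $\widehat\lambda_n(\xi)$ be the supremum of all real $\lambda$ such that for all sufficiently large $Q$ there is $(x_0,\dots,x_n)\in\mathbb Z^{n+1}$ with $1\le |x_0|\le Q$ and $\max_{1\le i\le n}|x_0\xi^i-x_i|<Q^{-\lambda}$. For a positive integer $k$, let $\omega_k(\xi)\in[k,\infty]$ be the supremum of all real $\omega$ such that for arbitrarily large $Q$ there is $P\in\mathbb Z[x]$ of degree at most $k$, with coefficients of absolute value at most $Q$, such that $0<|P(\xi)|\le Q^{-\omega}$. Put $$\delta_k=\frac{k}{\omega_k(\xi)+1-k}\qquad(\delta_k=0\text{ if }\omega_k(\xi)=\infty).$$ Theorem. Let $\xi\in\mathbb R$ be transcendental, let $k\ge 1$ be an integer and let $n$ be a positive integer. (1) If there are integers $m\ge k$ with $$2m+2\le n<2m+1+\Bigl(1-\frac1{n-m}\Bigr)(1+\delta_k),$$ then $\widehat\lambda_n(\xi)\le \frac1{n-m}$ for the least such $m$. (2) Suppose $\delta_k>0$, and let $m\ge k$ be an integer with $2m+2\le n$. Then the equation $$\frac1{\delta_k}-\frac{(n-m-1)x}{\delta_k(n-2m-1)}-\frac{(n-m-1)x}{n-2m-1}+\Bigl(\frac{1-x}{n-2m-1}-\frac{n-2m-2+x}{\delta_k(n-2m-1)}\Bigr)(m+1)x=0$$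 has exactly one positive root $x=x(m)$, and if $2m+1+(1-x(m))(1+\delta_k)\le n$, then $\widehat\lambda_n(\xi)\le x(m)$. -/

import Mathlib

open Filter Polynomial

noncomputable section

/-- The uniform simultaneous Diophantine exponent of `ξ`: the supremum, in the extended reals,
of all real `lam` such that for all large enough real `Q` there is an integer vector
`(x₀, …, xₙ)` with `1 ≤ |x₀| ≤ Q` and `max_{1 ≤ i ≤ n} |x₀ ξ ^ i - xᵢ| < Q ^ (-lam)`. -/
def uniformSimultaneousExponent (n : ℕ) (ξ : ℝ) : EReal :=
  sSup ((fun lam : ℝ => (lam : EReal)) '' {lam : ℝ |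
    ∀ᶠ Q : ℝ in atTop, ∃ x : Fin (n + 1) → ℤ,
      1 ≤ |(x 0 : ℝ)| ∧ |(x 0 : ℝ)| ≤ Q ∧
      ∀ i : Fin n, |(x 0 : ℝ) * ξ ^ ((i : ℕ) + 1) - (x i.succ : ℝ)| < Q ^ (-lam)})

/-- The dual Diophantine exponent of `ξ`: the supremum, in the extended reals, of all real `w`
such that for arbitrarily large real `Q` there is an integer polynomial `P` of degree at most `k`
whose coefficients are at most `Q` in absolute value and with `0 < |P(ξ)| ≤ Q ^ (-w)`. -/
def dualExponent (k : ℕ) (ξ : ℝ) : EReal :=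
  sSup ((fun w : ℝ => (w : EReal)) '' {w : ℝ |
    ∃ᶠ Q : ℝ in atTop, ∃ P : ℤ[X],
      P.natDegree ≤ k ∧ (∀ j : ℕ, |(P.coeff j : ℝ)| ≤ Q) ∧
      0 < |aeval ξ P| ∧ |aeval ξ P| ≤ Q ^ (-w)})

/-- `δ_k = k / (ω_k(ξ) + 1 - k)`. The quotient is taken in the extended reals, so that
it is `0` when `ω_k(ξ) = ∞`. -/
def deltaRatio (k : ℕ) (ξ : ℝ) : ℝ :=
  ((k : EReal) / (dualExponent k ξ + 1 - (k : EReal))).toReal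

/-- The quadratic polynomial whose positive root is `x(m)`, with `d` in the place of `δ_k`. -/
def rootQuadratic (n m : ℕ) (d x : ℝ) : ℝ :=
  1 / d - ((n : ℝ) - m - 1) * x / (d * ((n : ℝ) - 2 * m - 1))
    - ((n : ℝ) - m - 1) * x / ((n : ℝ) - 2 * m - 1)
    + ((1 - x) / ((n : ℝ) - 2 * m - 1)
        - ((n : ℝ) - 2 * m - 2 + x) / (d * ((n : ℝ) - 2 * m - 1))) * ((m : ℝ) + 1) * x

end

/-! Write `n = 2m + 1 + D` and suppose the uniform estimate holds with some `lam > 1/(n-m)`. Let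
`q_i` be the successive record denominators, `L_i` their errors and `y_i` the nearest integers to
`q_i ξ^j`, `j ≤ n`; then `L_i ≪ q_{i+1}^(-lam)`. The proof studies the recurrences of `y_i`
(`annih`). A polynomial with small height and small value at `ξ` is a recurrence, because its
pairings with the shifts of `y_i` are integers of absolute value less than `1`. Conversely a
recurrence `F` satisfies `|F(ξ)| ≪ H(F) L_i / q_i`, with `H` the height.

Absence of low degrees (`exists_annih_eq_bot`): Dirichlet's theorem gives `y_{i+1}` a small
recurrence of degree at most `n-m`. If `y_{i+1}` also has one of formal degree `m+1`, a minimal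
primitive recurrence divides the small one by Gauss's lemma, so it is small too and passes down to
`y_i`. The spaces of recurrences then decrease and stabilise. A common nonzero element would vanish
at `ξ`, against transcendence. Hence for large `i` there is no recurrence of formal degree `m+1`, so
`q_i L_i^(m+1) ≫ 1`, and those of formal degree `n-m` have dimension exactly `D+1`.

Upper bound (`height_pow_le`): the least height `A` of a recurrence of `y_i` of formal degree `n-m`
satisfies `A^D ≪ q_i L_i^m L_{i-1}`, by a box principle on a space of dimension `D`.

Lower bound (`exists_one_le_height_mul`): a recurrence of least height cannot survive forever. When
it dies between `y_i` and `y_{i+1}`, multiplying it by a suitable polynomial of degree at most `k`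
gives a nonzero integer pairing with a shift of `y_{i+1}`. For `w > ω_k` this yields `A
(q_{i+1}/q_i)^g L_i ≫ 1` with `g = (1+w-k)/(1+w)`, which tends to `1/(1+δ_k)` as `w` decreases to
`ω_k`.

In logarithms these are linear inequalities in `log q_i` and `log q_{i+1}` (`exists_log_bound`).
They fail for large `i` if `D/(1+δ_k) < 1 - lam`, which gives (1), or if `lam` lies beyond the
positive root of the quadratic, which gives (2). -/

noncomputable section

/-! ### Packing and the box principle. -/

/-- A `1`-separated family in a ball of radius `r` has at most `(2r+1)^d` elements. -/
theorem card_le_of_one_separated {E : Type*} [NormedAddCommGroup E] [NormedSpace ℝ E]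
    [FiniteDimensional ℝ E] (s : Finset E) {r : ℝ} (hr : 0 ≤ r) (hs : ∀ c ∈ s, ‖c‖ ≤ r)
    (h : ∀ c ∈ s, ∀ d ∈ s, c ≠ d → 1 ≤ ‖c - d‖) :
    (s.card : ℝ) ≤ (2 * r + 1) ^ Module.finrank ℝ E := by
  borelize E
  let μ : MeasureTheory.Measure E := MeasureTheory.Measure.addHaar
  have hδ : (0 : ℝ) < 1 / 2 := by norm_num
  have hρ : 0 < r + 1 / 2 := by positivity
  have hdisj : Set.Pairwise (s : Set E)
      (Function.onFun Disjoint fun c => Metric.ball (c : E) (1 / 2)) := by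
    rintro c hc d hd hcd
    apply Metric.ball_disjoint_ball
    rw [dist_eq_norm]
    linarith [h c hc d hd hcd]
  have hsub : (⋃ c ∈ s, Metric.ball (c : E) (1 / 2)) ⊆ Metric.ball (0 : E) (r + 1 / 2) := by
    refine Set.iUnion₂_subset fun x hx => ?_
    apply Metric.ball_subset_ball'
    rw [dist_zero_right]
    linarith [hs x hx]
  have I : (s.card : ENNReal) * ENNReal.ofReal ((1 / 2 : ℝ) ^ Module.finrank ℝ E)
        * μ (Metric.ball 0 1) ≤
      ENNReal.ofReal ((r + 1 / 2) ^ Module.finrank ℝ E) * μ (Metric.ball 0 1) :=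
    calc
      _ = μ (⋃ c ∈ s, Metric.ball (c : E) (1 / 2)) := by
        rw [MeasureTheory.measure_biUnion_finset hdisj fun c _ => measurableSet_ball]
        simp only [μ.addHaar_ball_of_pos _ hδ]
        simp only [Finset.sum_const, nsmul_eq_mul, mul_assoc]
      _ ≤ μ (Metric.ball (0 : E) (r + 1 / 2)) := MeasureTheory.measure_mono hsub
      _ = _ := by simp only [μ.addHaar_ball_of_pos _ hρ]
  have J : (s.card : ENNReal) * ENNReal.ofReal ((1 / 2 : ℝ) ^ Module.finrank ℝ E)
      ≤ ENNReal.ofReal ((r + 1 / 2) ^ Module.finrank ℝ E) :=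
    (ENNReal.mul_le_mul_iff_left (Metric.measure_ball_pos _ _ zero_lt_one).ne'
      MeasureTheory.measure_ball_lt_top.ne).1 I
  have K := ENNReal.toReal_le_of_le_ofReal (pow_nonneg hρ.le _) J
  rw [ENNReal.toReal_mul, ENNReal.toReal_natCast, ENNReal.toReal_ofReal (by positivity)] at K
  calc (s.card : ℝ) = (s.card * (1 / 2 : ℝ) ^ Module.finrank ℝ E) * 2 ^ Module.finrank ℝ E := by
        rw [mul_assoc, ← mul_pow]; norm_num
    _ ≤ (r + 1 / 2) ^ Module.finrank ℝ E * 2 ^ Module.finrank ℝ E := by gcongr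
    _ = _ := by rw [← mul_pow]; congr 1; ring

/-- Box principle combined with a packing bound: if the integer vectors of the box `‖u‖ ≤ R` on
which the functionals `ℓ t` are smaller than `w t` lie in a `d`-dimensional space, and `σ` maps them
into a ball of radius `r`, the nonzero ones outside the open unit ball, then `R` is bounded. -/
theorem box_card_le {N : ℕ} {κ : Type*} [Fintype κ] [DecidableEq κ] {W : Type*}
    [NormedAddCommGroup W] [NormedSpace ℝ W]
    (ℓ : κ → (Fin N → ℝ) →ₗ[ℝ] ℝ) (b w : κ → ℝ) (hw : ∀ t, 0 < w t) (R d : ℕ)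
    (hb : ∀ t, ∀ u : Fin N → ℝ, (∀ j, 0 ≤ u j ∧ u j ≤ R) → |ℓ t u| ≤ b t)
    (E : Submodule ℝ (Fin N → ℝ)) (hE : Module.finrank ℝ E ≤ d)
    (σ : (Fin N → ℝ) →ₗ[ℝ] W) {r : ℝ} (hr : 0 ≤ r)
    (h : ∀ u : Fin N → ℤ, (∀ j, |(u j : ℝ)| ≤ R) → (∀ t, |ℓ t (fun j => (u j : ℝ))| < w t) →
      (fun j => (u j : ℝ)) ∈ E ∧ ‖σ (fun j => (u j : ℝ))‖ ≤ r ∧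
        (u ≠ 0 → 1 ≤ ‖σ (fun j => (u j : ℝ))‖)) :
    ((R : ℝ) + 1) ^ N ≤ (∏ t, (2 * b t / w t + 2)) * (2 * r + 1) ^ d := by
  classical
  set B : Finset (Fin N → ℤ) := Fintype.piFinset fun _ => Finset.Icc (0 : ℤ) R with hB
  set cast : (Fin N → ℤ) → (Fin N → ℝ) := fun u j => (u j : ℝ) with hcast
  have hcast_sub : ∀ u v, cast (u - v) = cast u - cast v := by
    intro u v; ext j; simp [hcast]
  have hcast_inj : Function.Injective cast := by
    intro u v huv; ext j
    have := congrFun huv j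
    simpa [hcast] using this
  have hBmem : ∀ u ∈ B, ∀ j, (0 : ℝ) ≤ cast u j ∧ cast u j ≤ R := by
    intro u hu j
    have := Finset.mem_Icc.1 (Fintype.mem_piFinset.1 hu j)
    exact ⟨by simpa [hcast] using this.1, by
      have h2 := this.2
      simp only [hcast]; exact_mod_cast h2⟩
  have hBcard : B.card = (R + 1) ^ N := by
    rw [hB, Fintype.card_piFinset]; simp
  -- Pigeonhole: `g` records the cell of width `w t` containing each value, so `h` applies to the
  -- difference of two vectors in one cell.
  set g : (Fin N → ℤ) → (κ → ℤ) := fun u t => ⌊ℓ t (cast u) / w t⌋ with hg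
  set T : Finset (κ → ℤ) :=
    Fintype.piFinset fun t => Finset.Icc (⌊-(b t / w t)⌋) (⌊b t / w t⌋) with hT
  have hgT : ∀ u ∈ B, g u ∈ T := by
    intro u hu
    rw [hT, Fintype.mem_piFinset]
    intro t
    have h1 := abs_le.1 (hb t (cast u) (hBmem u hu))
    rw [Finset.mem_Icc]
    constructor
    · apply Int.floor_le_floor
      rw [← neg_div]
      exact div_le_div_of_nonneg_right h1.1 (hw t).le
    · apply Int.floor_le_floor
      exact div_le_div_of_nonneg_right h1.2 (hw t).le
  have hbnn : ∀ t, 0 ≤ b t := fun t => (abs_nonneg _).trans (hb t 0 (by simp))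
  have hTcard : (T.card : ℝ) ≤ ∏ t, (2 * b t / w t + 2) := by
    rw [hT, Fintype.card_piFinset]
    push_cast
    apply Finset.prod_le_prod
    · intros; positivity
    · intro t _
      have hnn : 0 ≤ b t / w t := div_nonneg (hbnn t) (hw t).le
      rw [Int.card_Icc]
      have h1 := Int.floor_le (b t / w t)
      have h2 := Int.lt_floor_add_one (-(b t / w t))
      have h3 : ⌊-(b t / w t)⌋ ≤ ⌊b t / w t⌋ := Int.floor_le_floor (by linarith)
      have h4 : (((⌊b t / w t⌋ + 1 - ⌊-(b t / w t)⌋).toNat : ℤ) : ℝ)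
          = ⌊b t / w t⌋ + 1 - ⌊-(b t / w t)⌋ := by
        rw [Int.toNat_of_nonneg (by linarith)]; push_cast; ring
      rw [Int.cast_natCast] at h4
      rw [h4, mul_div_assoc]
      linarith
  have hfib : ∀ y ∈ T, ((B.filter fun u => g u = y).card : ℝ) ≤ (2 * r + 1) ^ d := by
    intro y _
    set S := B.filter fun u => g u = y with hS
    rcases S.eq_empty_or_nonempty with hemp | ⟨v, hv⟩
    · rw [hemp]; simp only [Finset.card_empty, Nat.cast_zero]; positivity
    have hdiff : ∀ u ∈ S, ∀ u' ∈ S, (∀ j, |((u - u') j : ℝ)| ≤ R) ∧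
        (∀ t, |ℓ t (cast (u - u'))| < w t) := by
      intro u hu u' hu'
      have hu1 := Finset.mem_filter.1 hu
      have hu1' := Finset.mem_filter.1 hu'
      constructor
      · intro j
        have h1 := hBmem u hu1.1 j
        have h2 := hBmem u' hu1'.1 j
        simp only [hcast] at h1 h2
        simp only [Pi.sub_apply]
        push_cast
        rw [abs_le]; constructor <;> linarith [h1.1, h1.2, h2.1, h2.2]
      · intro t
        have h1 : ⌊ℓ t (cast u) / w t⌋ = ⌊ℓ t (cast u') / w t⌋ := by
          have := congrFun (hu1.2.trans hu1'.2.symm) t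
          simpa [hg] using this
        have h2 := Int.abs_sub_lt_one_of_floor_eq_floor h1
        rw [← sub_div, abs_div, abs_of_pos (hw t), div_lt_one (hw t)] at h2
        rw [hcast_sub, map_sub]
        exact h2
    set F := E.map σ with hF
    have hFd : Module.finrank ℝ F ≤ d := (Submodule.finrank_map_le σ E).trans hE
    have hmemF : ∀ u ∈ S, σ (cast (u - v)) ∈ F := fun u hu =>
      Submodule.mem_map_of_mem (h (u - v) (hdiff u hu v hv).1 (hdiff u hu v hv).2).1
    -- Translating a fibre by one of its members `v` places it in `E`. Its image under `σ` is then
    -- `1`-separated in a ball of dimension at most `d`.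
    set φ : {u // u ∈ S} → F := fun u => ⟨σ (cast (u.1 - v)), hmemF u.1 u.2⟩ with hφ
    have hsep : ∀ u u' : {u // u ∈ S}, u ≠ u' → 1 ≤ ‖φ u - φ u'‖ := by
      intro u u' hne
      have h1 := (h (u.1 - u'.1) (hdiff _ u.2 _ u'.2).1 (hdiff _ u.2 _ u'.2).2).2.2
        (sub_ne_zero.2 fun hc => hne (Subtype.ext hc))
      have h2 : ((φ u - φ u' : F) : W) = σ (cast (u.1 - u'.1)) := by
        simp only [hφ, AddSubgroupClass.coe_sub]
        rw [← map_sub, ← hcast_sub]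
        congr 2; abel
      change 1 ≤ ‖((φ u - φ u' : F) : W)‖
      rw [h2]
      exact h1
    have hinj : Function.Injective φ := by
      intro u u' huv
      by_contra hne
      have := hsep u u' hne
      rw [huv, sub_self, norm_zero] at this
      linarith
    have h3 := card_le_of_one_separated (Finset.univ.image φ) hr (by
      intro c hc
      obtain ⟨u, _, rfl⟩ := Finset.mem_image.1 hc
      exact (h (u.1 - v) (hdiff _ u.2 _ hv).1 (hdiff _ u.2 _ hv).2).2.1) (by
      intro c hc c' hc' hne
      obtain ⟨u, _, rfl⟩ := Finset.mem_image.1 hc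
      obtain ⟨u', _, rfl⟩ := Finset.mem_image.1 hc'
      exact hsep u u' fun hc => hne (by rw [hc]))
    rw [Finset.card_image_of_injective _ hinj, Finset.card_univ, Fintype.card_coe] at h3
    exact h3.trans (pow_le_pow_right₀ (by linarith) hFd)
  have hmain : (B.card : ℝ) ≤ T.card * (2 * r + 1) ^ d := by
    rw [Finset.card_eq_sum_card_fiberwise hgT]
    push_cast
    calc _ ≤ ∑ _y ∈ T, (2 * r + 1) ^ d := Finset.sum_le_sum hfib
      _ = _ := by rw [Finset.sum_const, nsmul_eq_mul]
  rw [hBcard] at hmain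
  push_cast at hmain
  exact hmain.trans (mul_le_mul_of_nonneg_right hTcard (by positivity))

/-! ### Polynomials as recurrences of finite sequences. -/

section Pairing

variable {R S : Type*} [CommRing R] [CommRing S]

/-- The polynomial with a given vector of coefficients. -/
def vecPoly (R : Type*) [CommRing R] (N : ℕ) : (Fin N → R) →ₗ[R] R[X] :=
  ∑ i : Fin N, (monomial (i : ℕ)).comp (LinearMap.proj i)

theorem vecPoly_apply {N : ℕ} (u : Fin N → R) : vecPoly R N u = ∑ i : Fin N, monomial i (u i) := by
  simp [vecPoly]

theorem vecPoly_coeff {N : ℕ} (u : Fin N → R) (j : ℕ) :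
    (vecPoly R N u).coeff j = if h : j < N then u ⟨j, h⟩ else 0 := by
  rw [vecPoly_apply, finsetSum_coeff]
  simp only [coeff_monomial]
  split_ifs with h
  · rw [Finset.sum_eq_single ⟨j, h⟩]
    · simp
    · intro b _ hb
      rw [if_neg]
      intro hc; apply hb; ext; exact hc
    · simp
  · apply Finset.sum_eq_zero
    intro b _
    rw [if_neg]
    intro hc; exact h (hc ▸ b.2)

theorem vecPoly_natDegree_le {a : ℕ} (u : Fin (a + 1) → R) :
    (vecPoly R (a + 1) u).natDegree ≤ a := by
  rw [natDegree_le_iff_coeff_eq_zero]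
  intro j hj
  rw [vecPoly_coeff, dif_neg (by omega)]

theorem vecPoly_injective (N : ℕ) : Function.Injective (vecPoly R N) := by
  intro u v h
  ext j
  have := congrArg (fun p => coeff p j) h
  simpa [vecPoly_coeff] using this

theorem exists_vecPoly_eq {a : ℕ} {F : R[X]} (hF : F.natDegree ≤ a) :
    ∃ u, vecPoly R (a + 1) u = F := by
  refine ⟨fun i => F.coeff i, ?_⟩
  ext j
  rw [vecPoly_coeff]
  split_ifs with h
  · rfl
  · rw [coeff_eq_zero_of_natDegree_lt (by omega)]

theorem vecPoly_map {N : ℕ} (f : R →+* S) (u : Fin N → R) :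
    (vecPoly R N u).map f = vecPoly S N (fun j => f (u j)) := by
  ext j
  simp only [coeff_map, vecPoly_coeff]
  split_ifs <;> simp

/-- The linear functional on polynomials with moments `y j`. -/
def pairing (y : ℕ → R) : R[X] →ₗ[R] R :=
  lsum fun j => LinearMap.smulRight (LinearMap.id : R →ₗ[R] R) (y j)

theorem pairing_monomial (y : ℕ → R) (j : ℕ) (c : R) : pairing y (monomial j c) = c * y j := by
  simp [pairing, lsum_apply, sum_monomial_index]

theorem pairing_X_pow (y : ℕ → R) (j : ℕ) : pairing y (X ^ j) = y j := by
  rw [X_pow_eq_monomial, pairing_monomial, one_mul]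

theorem pairing_mul_X_pow_eq_sum (y : ℕ → R) {F : R[X]} {a : ℕ} (hF : F.natDegree ≤ a) (s : ℕ) :
    pairing y (F * X ^ s) = ∑ j ∈ Finset.range (a + 1), F.coeff j * y (j + s) := by
  conv_lhs => rw [F.as_sum_range' (a + 1) (by omega)]
  rw [Finset.sum_mul, map_sum]
  refine Finset.sum_congr rfl fun j _ => ?_
  rw [monomial_mul_X_pow, pairing_monomial]

theorem pairing_mul_mul_X_pow (y : ℕ → R) (F : R[X]) {U : R[X]} {b : ℕ} (hU : U.natDegree ≤ b)
    (s : ℕ) : pairing y (F * U * X ^ s) =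
      ∑ l ∈ Finset.range (b + 1), U.coeff l * pairing y (F * X ^ (l + s)) := by
  conv_lhs => rw [U.as_sum_range' (b + 1) (by omega)]
  rw [Finset.mul_sum, Finset.sum_mul, map_sum]
  refine Finset.sum_congr rfl fun l _ => ?_
  rw [← C_mul_X_pow_eq_monomial, ← smul_eq_mul (a := U.coeff l), ← map_smul, smul_eq_C_mul]
  congr 1
  ring

theorem pairing_map (f : R →+* S) (y : ℕ → R) (F : R[X]) :
    pairing (fun j => f (y j)) (F.map f) = f (pairing y F) := by
  have h1 := pairing_mul_X_pow_eq_sum y (le_refl F.natDegree) 0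
  have h2 := pairing_mul_X_pow_eq_sum (fun j => f (y j)) (F := F.map f) natDegree_map_le 0
  simp only [pow_zero, mul_one] at h1 h2
  rw [h1, h2, map_sum]
  simp

/-- The polynomials of formal degree `a` that are recurrences for the finite sequence
`y 0, …, y n`. -/
def annih (y : ℕ → R) (n a : ℕ) : Submodule R R[X] where
  carrier := {F | F.natDegree ≤ a ∧ ∀ j, a + j ≤ n → pairing y (F * X ^ j) = 0}
  add_mem' := by
    rintro F G ⟨h1, h2⟩ ⟨h3, h4⟩
    exact ⟨natDegree_add_le_of_degree_le h1 h3, fun j hj => by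
      rw [add_mul, map_add, h2 j hj, h4 j hj, add_zero]⟩
  zero_mem' := ⟨by simp, fun j _ => by simp⟩
  smul_mem' := by
    rintro c F ⟨h1, h2⟩
    exact ⟨(natDegree_smul_le c F).trans h1, fun j hj => by
      rw [smul_mul_assoc, map_smul, h2 j hj, smul_zero]⟩

theorem mem_annih {y : ℕ → R} {n a : ℕ} {F : R[X]} :
    F ∈ annih y n a ↔ F.natDegree ≤ a ∧ ∀ j, a + j ≤ n → pairing y (F * X ^ j) = 0 := Iff.rfl

/-- Raising the formal degree by `b` leaves `b` fewer shifts to test, and the lost shifts are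
exactly those needed to expand `U`. -/
theorem mul_mem_annih {y : ℕ → R} {n a b : ℕ} {F U : R[X]} (hF : F ∈ annih y n a)
    (hU : U.natDegree ≤ b) : F * U ∈ annih y n (a + b) := by
  refine ⟨natDegree_mul_le_of_le hF.1 hU, fun j hj => ?_⟩
  rw [pairing_mul_mul_X_pow y F hU]
  refine Finset.sum_eq_zero fun l hl => ?_
  rw [hF.2 (l + j) (by have := Finset.mem_range.1 hl; omega), mul_zero]

theorem annih_mono (y : ℕ → R) (n : ℕ) : Monotone (annih y n) := by
  intro a b hab F hF
  have := mul_mem_annih (U := 1) (b := b - a) hF (by simp)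
  rwa [mul_one, Nat.add_sub_cancel' hab] at this

theorem mem_annih_map_iff {f : R →+* S} (hf : Function.Injective f) (y : ℕ → R) (n a : ℕ) (F : R[X]) :
    F.map f ∈ annih (fun j => f (y j)) n a ↔ F ∈ annih y n a := by
  rw [mem_annih, mem_annih, natDegree_map_eq_of_injective hf]
  have : ∀ j, pairing (fun j => f (y j)) (F.map f * X ^ j) = f (pairing y (F * X ^ j)) := by
    intro j
    rw [← pairing_map]
    simp
  simp only [this, map_eq_zero_iff f hf]

end Pairing

/-! ### Dimension counts for recurrences over a field. -/

section Field

variable {𝕜 : Type*} [Field 𝕜]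

/-- The functional `F ↦ pairing y (F * X ^ s)` on coefficient vectors. -/
def pairingVec (y : ℕ → 𝕜) (N s : ℕ) : (Fin N → 𝕜) →ₗ[𝕜] 𝕜 :=
  (pairing y).comp ((LinearMap.mulRight 𝕜 (X ^ s)).comp (vecPoly 𝕜 N))

theorem pairingVec_apply (y : ℕ → 𝕜) (N s : ℕ) (u : Fin N → 𝕜) :
    pairingVec y N s u = pairing y (vecPoly 𝕜 N u * X ^ s) := rfl

theorem finrank_ker_pi_add_card {V : Type*} [AddCommGroup V] [Module 𝕜 V] [FiniteDimensional 𝕜 V]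
    {ι : Type*} [Fintype ι] {f : ι → Module.Dual 𝕜 V} (hf : LinearIndependent 𝕜 f) :
    Module.finrank 𝕜 (LinearMap.ker (LinearMap.pi f)) + Fintype.card ι = Module.finrank 𝕜 V := by
  have h1 := Subspace.finrank_add_finrank_dualCoannihilator_eq (Submodule.span 𝕜 (Set.range f))
  rw [finrank_span_eq_card hf] at h1
  have h2 : (Submodule.span 𝕜 (Set.range f)).dualCoannihilator = LinearMap.ker (LinearMap.pi f) := by
    ext v
    rw [Submodule.mem_dualCoannihilator, LinearMap.mem_ker]
    constructor
    · intro h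
      ext i
      exact h (f i) (Submodule.subset_span ⟨i, rfl⟩)
    · intro h φ hφ
      induction hφ using Submodule.span_induction with
      | mem x hx => obtain ⟨i, rfl⟩ := hx; exact congrFun h i
      | zero => rfl
      | add x y _ _ hx hy => rw [LinearMap.add_apply, hx, hy, add_zero]
      | smul c x _ hx => rw [LinearMap.smul_apply, hx, smul_zero]
  rw [← h2]; omega

/-- The shifts of `y` are independent when `y` has no recurrence of formal degree `a`. -/
theorem linearIndependent_pairingVec {y : ℕ → 𝕜} {n a b : ℕ} (h : annih y n a = ⊥) (hab : a + b = n) :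
    LinearIndependent 𝕜 (fun j : Fin (a + 1) => pairingVec y (b + 1) (j : ℕ)) := by
  rw [Fintype.linearIndependent_iff]
  intro c hc
  -- By the symmetry of the Hankel matrix `y (j + l)`, a linear relation between shifts is itself a
  -- recurrence.
  have hmem : vecPoly 𝕜 (a + 1) c ∈ annih y n a := by
    refine ⟨vecPoly_natDegree_le c, fun l hl => ?_⟩
    obtain ⟨u, hu⟩ := exists_vecPoly_eq (R := 𝕜) (a := b) (F := X ^ l)
      ((natDegree_X_pow_le l).trans (by omega))
    have h1 := LinearMap.congr_fun hc u
    simp only [LinearMap.sum_apply, LinearMap.smul_apply, pairingVec_apply, hu, smul_eq_mul,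
      LinearMap.zero_apply] at h1
    rw [pairing_mul_X_pow_eq_sum y (vecPoly_natDegree_le c), Finset.sum_range, ← h1]
    refine Finset.sum_congr rfl fun j _ => ?_
    rw [← pow_add, pairing_X_pow, vecPoly_coeff, dif_pos j.2, add_comm (j : ℕ) l]
  rw [h, Submodule.mem_bot] at hmem
  have : c = 0 := vecPoly_injective _ (by rw [hmem, map_zero])
  simp [this]

theorem finrank_ker_pi_pairingVec {y : ℕ → 𝕜} {n a b : ℕ} (h : annih y n a = ⊥) (hab : a + b = n) :
    Module.finrank 𝕜 (LinearMap.ker (LinearMap.pi fun j : Fin (a + 1) =>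
      pairingVec y (b + 1) (j : ℕ))) + (a + 1) = b + 1 := by
  have h1 := linearIndependent_pairingVec h hab
  have h2 := finrank_ker_pi_add_card h1
  rw [Module.finrank_fin_fun, Fintype.card_fin] at h2
  exact h2

theorem mem_ker_pi_pairingVec {y : ℕ → 𝕜} {n a b : ℕ} (hab : a + b = n) (u : Fin (b + 1) → 𝕜) :
    u ∈ LinearMap.ker (LinearMap.pi fun j : Fin (a + 1) => pairingVec y (b + 1) (j : ℕ)) ↔
      vecPoly 𝕜 (b + 1) u ∈ annih y n b := by
  rw [LinearMap.mem_ker, mem_annih]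
  constructor
  · intro h
    exact ⟨vecPoly_natDegree_le u, fun j hj => congrFun h ⟨j, by omega⟩⟩
  · rintro ⟨_, h⟩
    ext j
    exact h j (by have := j.2; omega)

/-- If `Q` is a nonzero recurrence of minimal formal degree `h + 1`, the recurrences of the
complementary formal degree are the multiples of `Q`. -/
theorem exists_eq_mul_of_mem_annih {y : ℕ → 𝕜} {n h b c : ℕ} (hmin : annih y n h = ⊥)
    (hb : h + b = n) (hc : h + 1 + c = b) {Q G : 𝕜[X]} (hQ : Q ∈ annih y n (h + 1)) (hQ0 : Q ≠ 0)
    (hG : G ∈ annih y n b) : ∃ U : 𝕜[X], U.natDegree ≤ c ∧ G = Q * U := by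
  set K := LinearMap.ker (LinearMap.pi fun j : Fin (h + 1) => pairingVec y (b + 1) (j : ℕ)) with hK
  have hKdim : Module.finrank 𝕜 K + (h + 1) = b + 1 := by
    exact finrank_ker_pi_pairingVec hmin hb
  set M : Submodule 𝕜 𝕜[X] := K.map (vecPoly 𝕜 (b + 1)) with hM
  set P : Submodule 𝕜 𝕜[X] :=
    LinearMap.range ((LinearMap.mulLeft 𝕜 Q).comp (vecPoly 𝕜 (c + 1))) with hP
  -- The multiples of `Q` already fill the space of recurrences, since both have dimension `(b + 1)
  -- - (h + 1) = c + 1`.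
  have hMdim : Module.finrank 𝕜 M = c + 1 := by
    rw [hM, (Submodule.equivMapOfInjective _ (vecPoly_injective _) K).finrank_eq.symm]
    omega
  have hPdim : Module.finrank 𝕜 P = c + 1 := by
    rw [hP, LinearMap.finrank_range_of_inj]
    · simp
    · rw [LinearMap.coe_comp]
      exact Function.Injective.comp (mul_right_injective₀ hQ0) (vecPoly_injective _)
  have hPM : P ≤ M := by
    rintro _ ⟨v, rfl⟩
    have h1 : Q * vecPoly 𝕜 (c + 1) v ∈ annih y n b := by
      rw [← hc]; exact mul_mem_annih hQ (vecPoly_natDegree_le v)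
    obtain ⟨u, hu⟩ := exists_vecPoly_eq h1.1
    refine ⟨u, ?_, hu⟩
    rw [SetLike.mem_coe, hK, mem_ker_pi_pairingVec hb, hu]
    exact h1
  have : FiniteDimensional 𝕜 M := by rw [hM]; infer_instance
  have hEq : P = M := Submodule.eq_of_le_of_finrank_eq hPM (by rw [hPdim, hMdim])
  obtain ⟨u, hu⟩ := exists_vecPoly_eq hG.1
  have hGM : G ∈ M := ⟨u, by rw [SetLike.mem_coe, hK, mem_ker_pi_pairingVec hb, hu]; exact hG, hu⟩
  rw [← hEq] at hGM
  obtain ⟨v, hv⟩ := hGM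
  exact ⟨_, vecPoly_natDegree_le v, hv.symm⟩

/-- A sequence without recurrence of formal degree `a + 1` is determined, up to a factor, by its
recurrences of formal degree `n - a`. -/
theorem eq_smul_of_annih_le {y z : ℕ → 𝕜} {n a b : ℕ} (hab : a + b = n)
    (h : annih y n (a + 1) = ⊥) (hle : annih y n b ≤ annih z n b) :
    ∃ t : 𝕜, ∀ j ≤ n, z j = t * y j := by
  -- By duality, the inclusion of common kernels writes each shift of `z` as a combination of shifts
  -- of `y`, encoded by a polynomial `A s`.
  have hspan : ∀ s : Fin (a + 1), ∃ A : 𝕜[X], A.natDegree ≤ a ∧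
      ∀ l ≤ b, z (l + s) = pairing y (A * X ^ l) := by
    intro s
    have h1 : pairingVec z (b + 1) (s : ℕ) ∈ Submodule.span 𝕜
        (Set.range fun j : Fin (a + 1) => pairingVec y (b + 1) (j : ℕ)) := by
      apply mem_span_of_iInf_ker_le_ker
      intro u hu
      have h2 : u ∈ LinearMap.ker (LinearMap.pi fun j : Fin (a + 1) =>
          pairingVec y (b + 1) (j : ℕ)) := by
        rw [LinearMap.mem_ker]; ext j
        exact (Submodule.mem_iInf _).1 hu j
      rw [mem_ker_pi_pairingVec hab] at h2
      exact (hle h2).2 s (by have := s.2; omega)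
    obtain ⟨c, hc⟩ := (Submodule.mem_span_range_iff_exists_fun 𝕜).1 h1
    refine ⟨vecPoly 𝕜 (a + 1) c, vecPoly_natDegree_le c, fun l hl => ?_⟩
    obtain ⟨u, hu⟩ := exists_vecPoly_eq (R := 𝕜) (a := b) (F := X ^ l)
      ((natDegree_X_pow_le l).trans (by omega))
    have h3 := LinearMap.congr_fun hc u
    simp only [LinearMap.sum_apply, LinearMap.smul_apply, pairingVec_apply, hu, smul_eq_mul,
      ← pow_add, pairing_X_pow] at h3
    rw [← h3, pairing_mul_X_pow_eq_sum y (vecPoly_natDegree_le c), Finset.sum_range]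
    refine Finset.sum_congr rfl fun j _ => ?_
    rw [vecPoly_coeff, dif_pos j.2, add_comm l (j : ℕ)]
  choose A hA1 hA2 using hspan
  -- Both sides describe the same shift of `z`, so their difference is a recurrence of `y` of formal
  -- degree `a + 1`.
  have hstep : ∀ s (hs : s + 1 < a + 1), A ⟨s + 1, hs⟩ = A ⟨s, by omega⟩ * X := by
    intro s hs
    have hmem : A ⟨s, by omega⟩ * X - A ⟨s + 1, hs⟩ ∈ annih y n (a + 1) := by
      refine ⟨?_, fun l hl => ?_⟩
      · apply (natDegree_sub_le _ _).trans
        apply max_le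
        · exact natDegree_mul_le_of_le (hA1 _) natDegree_X_le
        · exact (hA1 _).trans (by omega)
      · rw [sub_mul, map_sub, mul_assoc, ← pow_succ', ← hA2 _ _ (by omega), ← hA2 _ _ (by omega),
          sub_eq_zero]
        congr 1
        simp only
        omega
    rw [h, Submodule.mem_bot, sub_eq_zero] at hmem
    exact hmem.symm
  have hpow : ∀ s (hs : s < a + 1), A ⟨s, hs⟩ = A ⟨0, by omega⟩ * X ^ s := by
    intro s
    induction s with
    | zero => intro _; simp
    | succ s ih => intro hs; rw [hstep s hs, ih (by omega), pow_succ, mul_assoc]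
  -- `A 0 * X ^ a` still has degree at most `a`.
  have hconst : (A ⟨0, by omega⟩).natDegree = 0 := by
    by_contra hne
    have h0 : A ⟨0, by omega⟩ ≠ 0 := fun hc => hne (by rw [hc, natDegree_zero])
    have h1 := hA1 ⟨a, by omega⟩
    rw [hpow, natDegree_mul_X_pow _ h0] at h1
    omega
  refine ⟨(A ⟨0, by omega⟩).coeff 0, fun j hj => ?_⟩
  have h1 := hA2 ⟨min j a, by omega⟩ (j - min j a) (by omega)
  rw [hpow, eq_C_of_natDegree_eq_zero hconst, mul_assoc, ← pow_add, ← smul_eq_C_mul, map_smul,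
    pairing_X_pow] at h1
  simp only at h1
  rw [Nat.sub_add_cancel (min_le_left _ _), Nat.add_sub_cancel' (min_le_left _ _)] at h1
  simpa using h1

/-- The recurrences of `y` killed by one more functional, in the case where that functional does
not kill all of them. -/
theorem finrank_le_of_annih {y z : ℕ → 𝕜} {n a b s d : ℕ} (hab : a + b = n) (hd : a + 1 + d = b)
    (h : annih y n a = ⊥) {G : 𝕜[X]} (hG : G ∈ annih y n b) (hGz : pairing z (G * X ^ s) ≠ 0) :
    Module.finrank 𝕜 ((LinearMap.ker (LinearMap.pi fun j : Fin (a + 1) =>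
      pairingVec y (b + 1) (j : ℕ)) ⊓ LinearMap.ker (pairingVec z (b + 1) s) :
        Submodule 𝕜 (Fin (b + 1) → 𝕜))) ≤ d := by
  set K := LinearMap.ker (LinearMap.pi fun j : Fin (a + 1) => pairingVec y (b + 1) (j : ℕ)) with hK
  have hKdim : Module.finrank 𝕜 K + (a + 1) = b + 1 := by
    exact finrank_ker_pi_pairingVec h hab
  obtain ⟨u, hu⟩ := exists_vecPoly_eq hG.1
  have hlt : K ⊓ LinearMap.ker (pairingVec z (b + 1) s) < K := by
    refine lt_of_le_of_ne inf_le_left fun heq => hGz ?_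
    have huK : u ∈ K := by rw [hK, mem_ker_pi_pairingVec hab, hu]; exact hG
    rw [← heq] at huK
    have := huK.2
    rw [← hu]
    exact this
  have := Submodule.finrank_lt_finrank_of_lt hlt
  omega

end Field

/-- The rational points of a rational subspace lie in a real subspace of the same dimension. -/
theorem exists_real_submodule {N : ℕ} (V : Submodule ℚ (Fin N → ℚ)) :
    ∃ E : Submodule ℝ (Fin N → ℝ), Module.finrank ℝ E ≤ Module.finrank ℚ V ∧
      ∀ v ∈ V, (fun j => ((v j : ℚ) : ℝ)) ∈ E := by
  classical
  set e := Module.finBasis ℚ V with he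
  set w : Fin (Module.finrank ℚ V) → (Fin N → ℝ) := fun i j => ((e i).1 j : ℝ) with hw
  refine ⟨Submodule.span ℝ (Set.range w), ?_, fun v hv => ?_⟩
  · exact (finrank_range_le_card w).trans (by simp)
  · rw [Submodule.mem_span_range_iff_exists_fun]
    refine ⟨fun i => ((e.repr ⟨v, hv⟩ i : ℚ) : ℝ), ?_⟩
    have h1 := congrArg Subtype.val (e.sum_repr ⟨v, hv⟩)
    ext j
    have h2 := congrFun h1 j
    simp only [Submodule.coe_sum, Submodule.coe_smul, Finset.sum_apply, Pi.smul_apply,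
      smul_eq_mul] at h2
    rw [← h2]
    simp [hw]

/-! ### Heights, nearest-integer sequences and their recurrences. -/

/-- The largest absolute value of the coefficients of an integer polynomial. -/
def height (F : ℤ[X]) : ℕ := F.support.sup fun j => (F.coeff j).natAbs

theorem natAbs_coeff_le_height (F : ℤ[X]) (j : ℕ) : (F.coeff j).natAbs ≤ height F := by
  by_cases h : j ∈ F.support
  · exact Finset.le_sup (f := fun j => (F.coeff j).natAbs) h
  · rw [notMem_support_iff.1 h]; simp

theorem abs_coeff_le_height (F : ℤ[X]) (j : ℕ) : |(F.coeff j : ℝ)| ≤ height F := by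
  have h := natAbs_coeff_le_height F j
  rw [← Int.cast_abs, Int.abs_eq_natAbs]
  exact_mod_cast h

theorem height_le_of_abs_coeff_le {F : ℤ[X]} {R : ℝ} (hR : 0 ≤ R) (h : ∀ j, |(F.coeff j : ℝ)| ≤ R) :
    (height F : ℝ) ≤ R := by
  rw [← Nat.le_floor_iff hR]
  refine Finset.sup_le fun j _ => ?_
  rw [Nat.le_floor_iff hR, Nat.cast_natAbs, Int.cast_abs]
  exact h j

theorem one_le_height {F : ℤ[X]} (h : F ≠ 0) : 1 ≤ height F := by
  refine le_trans ?_ (natAbs_coeff_le_height F F.natDegree)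
  rw [coeff_natDegree]
  exact Nat.one_le_iff_ne_zero.2 (Int.natAbs_ne_zero.2 (leadingCoeff_ne_zero.2 h))

/-- A common bound for `1, |ξ|, …, |ξ| ^ n`. -/
def powBound (ξ : ℝ) (n : ℕ) : ℝ := max 1 |ξ| ^ n

theorem one_le_powBound (ξ : ℝ) (n : ℕ) : 1 ≤ powBound ξ n := one_le_pow₀ (le_max_left _ _)

theorem abs_pow_le_powBound (ξ : ℝ) {n j : ℕ} (h : j ≤ n) : |ξ ^ j| ≤ powBound ξ n := by
  rw [abs_pow]
  calc |ξ| ^ j ≤ max 1 |ξ| ^ j := by gcongr; exact le_max_right _ _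
    _ ≤ _ := pow_le_pow_right₀ (le_max_left _ _) h

/-- The nearest integers to `q, q ξ, q ξ ^ 2, …`. -/
def approxSeq (ξ : ℝ) (q j : ℕ) : ℤ := round ((q : ℝ) * ξ ^ j)

/-- The largest distance of `q, q ξ, …, q ξ ^ n` to the nearest integer. -/
def approxErr (ξ : ℝ) (n q : ℕ) : ℝ :=
  (Finset.range (n + 1)).sup' Finset.nonempty_range_add_one
    fun j => |(q : ℝ) * ξ ^ j - approxSeq ξ q j|

section

variable {ξ : ℝ} {n : ℕ}

theorem abs_sub_approxSeq_le {j : ℕ} (q : ℕ) (h : j ≤ n) :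
    |(q : ℝ) * ξ ^ j - approxSeq ξ q j| ≤ approxErr ξ n q :=
  Finset.le_sup' (f := fun j => |(q : ℝ) * ξ ^ j - approxSeq ξ q j|)
    (Finset.mem_range.2 (Nat.lt_succ_of_le h))

theorem approxErr_nonneg (q : ℕ) : 0 ≤ approxErr ξ n q :=
  (abs_nonneg _).trans (abs_sub_approxSeq_le q (Nat.zero_le n))

theorem approxErr_le_one (q : ℕ) : approxErr ξ n q ≤ 1 := by
  apply Finset.sup'_le
  intro j _
  exact (abs_sub_round _).trans (by norm_num)

theorem approxErr_pos (hξ : Irrational ξ) (hn : 1 ≤ n) {q : ℕ} (hq : 1 ≤ q) :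
    0 < approxErr ξ n q := by
  refine lt_of_lt_of_le ?_ (abs_sub_approxSeq_le (j := 1) q hn)
  rw [abs_pos, sub_ne_zero, pow_one]
  have h := hξ.natCast_mul (m := q) (by omega)
  exact h.ne_int _

theorem abs_eval_le {F : ℝ[X]} {R : ℝ} {a : ℕ} (hF : F.natDegree ≤ a) (ha : a ≤ n)
    (hR : ∀ j, |F.coeff j| ≤ R) : |F.eval ξ| ≤ (n + 1) * powBound ξ n * R := by
  have hR0 : 0 ≤ R := (abs_nonneg _).trans (hR 0)
  have hΞ := one_le_powBound ξ n
  rw [eval_eq_sum_range' (n := a + 1) (by omega)]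
  calc _ ≤ ∑ j ∈ Finset.range (a + 1), |F.coeff j * ξ ^ j| := Finset.abs_sum_le_sum_abs _ _
    _ ≤ ∑ _j ∈ Finset.range (a + 1), powBound ξ n * R := by
        refine Finset.sum_le_sum fun j hj => ?_
        rw [abs_mul, mul_comm]
        have : j ≤ n := by have := Finset.mem_range.1 hj; omega
        exact mul_le_mul (abs_pow_le_powBound ξ this) (hR j) (abs_nonneg _) (by linarith)
    _ = (a + 1) * (powBound ξ n * R) := by simp
    _ ≤ (n + 1) * (powBound ξ n * R) := by gcongr
    _ = _ := by ring

theorem abs_pairing_sub_le {F : ℝ[X]} {R : ℝ} {a s : ℕ} (q : ℕ) (hF : F.natDegree ≤ a)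
    (ha : a + s ≤ n) (hR : ∀ j, |F.coeff j| ≤ R) :
    |pairing (fun j => (approxSeq ξ q j : ℝ)) (F * X ^ s) - q * ξ ^ s * F.eval ξ| ≤
      (n + 1) * R * approxErr ξ n q := by
  have hR0 : 0 ≤ R := (abs_nonneg _).trans (hR 0)
  have hL := approxErr_nonneg (ξ := ξ) (n := n) q
  rw [pairing_mul_X_pow_eq_sum _ hF, eval_eq_sum_range' (n := a + 1) (by omega), Finset.mul_sum,
    ← Finset.sum_sub_distrib]
  calc _ ≤ ∑ j ∈ Finset.range (a + 1),
        |F.coeff j * (approxSeq ξ q (j + s) : ℝ) - q * ξ ^ s * (F.coeff j * ξ ^ j)| :=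
        Finset.abs_sum_le_sum_abs _ _
    _ ≤ ∑ _j ∈ Finset.range (a + 1), R * approxErr ξ n q := by
        refine Finset.sum_le_sum fun j hj => ?_
        have h1 : F.coeff j * (approxSeq ξ q (j + s) : ℝ) - q * ξ ^ s * (F.coeff j * ξ ^ j)
            = F.coeff j * -(q * ξ ^ (j + s) - approxSeq ξ q (j + s)) := by
          rw [pow_add]; ring
        rw [h1, abs_mul, abs_neg]
        have : j + s ≤ n := by have := Finset.mem_range.1 hj; omega
        exact mul_le_mul (hR j) (abs_sub_approxSeq_le q this) (abs_nonneg _) hR0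
    _ = (a + 1) * (R * approxErr ξ n q) := by simp
    _ ≤ (n + 1) * (R * approxErr ξ n q) := by
        gcongr
        exact_mod_cast (by omega : a ≤ n)
    _ = _ := by ring

theorem aeval_eq_eval_map (F : ℤ[X]) : aeval ξ F = (F.map (Int.castRingHom ℝ)).eval ξ := by
  rw [eval_map, aeval_def]; rfl

theorem intCast_pairing (y : ℕ → ℤ) (F : ℤ[X]) :
    ((pairing y F : ℤ) : ℝ) = pairing (fun j => (y j : ℝ)) (F.map (Int.castRingHom ℝ)) :=
  (pairing_map (Int.castRingHom ℝ) y F).symm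

theorem abs_intPairing_sub_le {F : ℤ[X]} {R : ℝ} {a s : ℕ} (q : ℕ) (hF : F.natDegree ≤ a)
    (ha : a + s ≤ n) (hR : ∀ j, |(F.coeff j : ℝ)| ≤ R) :
    |((pairing (approxSeq ξ q) (F * X ^ s) : ℤ) : ℝ) - q * ξ ^ s * aeval ξ F| ≤
      (n + 1) * R * approxErr ξ n q := by
  have := abs_pairing_sub_le (ξ := ξ) (n := n) (F := F.map (Int.castRingHom ℝ)) (R := R) q
    (natDegree_map_le.trans hF) ha (by intro j; rw [coeff_map]; exact hR j)
  rw [intCast_pairing, aeval_eq_eval_map]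
  simpa using this

theorem mul_abs_aeval_le_of_mem_annih {F : ℤ[X]} {a q : ℕ} (hF : F ∈ annih (approxSeq ξ q) n a)
    (ha : a ≤ n) : q * |aeval ξ F| ≤ (n + 1) * height F * approxErr ξ n q := by
  have h1 := abs_intPairing_sub_le (ξ := ξ) (n := n) (s := 0) q hF.1 ha (abs_coeff_le_height F)
  rw [hF.2 0 ha] at h1
  rw [pow_zero, mul_one, Int.cast_zero, zero_sub, abs_neg, abs_mul, Nat.abs_cast] at h1
  exact h1

/-- Being a recurrence at `q` makes `q |F(ξ)|` of size `height F` times the error. Since `q' ≤ q`,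
the main term `q' ξ^s F(ξ)` at `q'` is then no larger than the error term there. -/
theorem abs_intPairing_le_of_mem_annih {F : ℤ[X]} {a s q q' : ℕ}
    (hF : F ∈ annih (approxSeq ξ q) n a) (hs : a + s ≤ n) (hqq : q' ≤ q)
    (hL : approxErr ξ n q ≤ approxErr ξ n q') :
    |((pairing (approxSeq ξ q') (F * X ^ s) : ℤ) : ℝ)| ≤
      (n + 1) * (powBound ξ n + 1) * height F * approxErr ξ n q' := by
  have h1 := abs_intPairing_sub_le (ξ := ξ) (n := n) q' hF.1 hs (abs_coeff_le_height F)
  have h2 := mul_abs_aeval_le_of_mem_annih hF (by omega)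
  have h3 : |(q' : ℝ) * ξ ^ s * aeval ξ F| ≤
      powBound ξ n * ((n + 1) * height F * approxErr ξ n q') := by
    rw [abs_mul, abs_mul, Nat.abs_cast]
    have h4 := abs_pow_le_powBound ξ (n := n) (j := s) (by omega)
    have h5 : (q' : ℝ) ≤ q := by exact_mod_cast hqq
    calc (q' : ℝ) * |ξ ^ s| * |aeval ξ F| = |ξ ^ s| * (q' * |aeval ξ F|) := by ring
      _ ≤ powBound ξ n * (q * |aeval ξ F|) := by
          have := one_le_powBound ξ n
          gcongr
      _ ≤ powBound ξ n * ((n + 1) * height F * approxErr ξ n q) := by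
          have := one_le_powBound ξ n
          gcongr
      _ ≤ _ := by
          have := one_le_powBound ξ n
          gcongr
  have h6 := abs_add_le (((pairing (approxSeq ξ q') (F * X ^ s) : ℤ) : ℝ) - q' * ξ ^ s * aeval ξ F)
    (q' * ξ ^ s * aeval ξ F)
  rw [sub_add_cancel] at h6
  linarith

theorem intCast_eq_zero_of_abs_lt_one {z : ℤ} (h : |(z : ℝ)| < 1) : z = 0 := by
  rw [← Int.abs_lt_one_iff]
  exact_mod_cast h

theorem mem_annih_of_mem_annih {F : ℤ[X]} {a q q' : ℕ}
    (hF : F ∈ annih (approxSeq ξ q) n a) (hqq : q' ≤ q)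
    (hL : approxErr ξ n q ≤ approxErr ξ n q')
    (hsmall : (n + 1) * (powBound ξ n + 1) * height F * approxErr ξ n q' < 1) :
    F ∈ annih (approxSeq ξ q') n a :=
  ⟨hF.1, fun _ hj => intCast_eq_zero_of_abs_lt_one
    ((abs_intPairing_le_of_mem_annih hF hj hqq hL).trans_lt hsmall)⟩

end

/-! ### Sequences of record denominators. -/

/-- A positive function with infimum `0` has a sequence of successive strict minima. -/
theorem exists_strict_records {L : ℕ → ℝ} (hpos : ∀ q, 1 ≤ q → 0 < L q)
    (hinf : ∀ ε > 0, ∃ q, 1 ≤ q ∧ L q < ε) :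
    ∃ q : ℕ → ℕ, StrictMono q ∧ (∀ i, 1 ≤ q i) ∧ StrictAnti (fun i => L (q i)) ∧
      ∀ i q', 1 ≤ q' → q' < q (i + 1) → L (q i) ≤ L q' := by
  classical
  have hex : ∀ x : {q : ℕ // 1 ≤ q ∧ ∀ q', 1 ≤ q' → q' ≤ q → L q ≤ L q'},
      ∃ q', L q' < L x.1 ∧ 1 ≤ q' := by
    intro x
    obtain ⟨q, h1, h2⟩ := hinf (L x.1) (hpos _ x.2.1)
    exact ⟨q, h2, h1⟩
  have hfind : ∀ x : {q : ℕ // 1 ≤ q ∧ ∀ q', 1 ≤ q' → q' ≤ q → L q ≤ L q'},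
      ∀ q', 1 ≤ q' → q' < Nat.find (hex x) → L x.1 ≤ L q' := by
    intro x q' h1 h2
    have := Nat.find_min (hex x) h2
    by_contra h
    exact this ⟨not_le.1 h, h1⟩
  set next : {q : ℕ // 1 ≤ q ∧ ∀ q', 1 ≤ q' → q' ≤ q → L q ≤ L q'} →
      {q : ℕ // 1 ≤ q ∧ ∀ q', 1 ≤ q' → q' ≤ q → L q ≤ L q'} := fun x =>
    ⟨Nat.find (hex x), (Nat.find_spec (hex x)).2, fun q' h1 h2 => by
      rcases h2.lt_or_eq with h | h
      · exact (Nat.find_spec (hex x)).1.le.trans (hfind x q' h1 h)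
      · rw [h]⟩ with hnext
  set f : ℕ → {q : ℕ // 1 ≤ q ∧ ∀ q', 1 ≤ q' → q' ≤ q → L q ≤ L q'} := fun i =>
    next^[i] ⟨1, le_refl 1, fun q' h1 h2 => by rw [le_antisymm h2 h1]⟩ with hf
  have hsucc : ∀ i, (f (i + 1)).1 = Nat.find (hex (f i)) := by
    intro i
    simp only [hf, Function.iterate_succ', Function.comp_apply]
    rfl
  refine ⟨fun i => (f i).1, ?_, fun i => (f i).2.1, ?_, ?_⟩
  · apply strictMono_nat_of_lt_succ
    intro i
    rw [hsucc]
    by_contra h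
    have h1 := Nat.find_spec (hex (f i))
    exact absurd h1.1 (not_lt.2 ((f i).2.2 _ h1.2 (not_lt.1 h)))
  · apply strictAnti_nat_of_succ_lt
    intro i
    show L (f (i + 1)).1 < L (f i).1
    rw [hsucc]
    exact (Nat.find_spec (hex (f i))).1
  · intro i q' h1 h2
    have h3 : q' < (f (i + 1)).1 := h2
    rw [hsucc] at h3
    exact hfind (f i) q' h1 h3

/-- A sequence of denominators with decreasing errors that satisfies a uniform estimate with
exponent `lam`. -/
structure IsRecordSeq (ξ : ℝ) (n : ℕ) (lam C : ℝ) (q : ℕ → ℕ) : Prop where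
  strictMono : StrictMono q
  one_le : ∀ i, 1 ≤ q i
  anti : StrictAnti fun i => approxErr ξ n (q i)
  bound : ∀ i, approxErr ξ n (q i) ≤ C * (q (i + 1) : ℝ) ^ (-lam)

theorem approxErr_le_of_forall {ξ : ℝ} {n : ℕ} {Q B : ℝ} (hB : 0 < B) {x : Fin (n + 1) → ℤ}
    (h1 : 1 ≤ |(x 0 : ℝ)|) (h2 : |(x 0 : ℝ)| ≤ Q)
    (h3 : ∀ i : Fin n, |(x 0 : ℝ) * ξ ^ ((i : ℕ) + 1) - (x i.succ : ℝ)| < B) :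
    ∃ q : ℕ, 1 ≤ q ∧ (q : ℝ) ≤ Q ∧ approxErr ξ n q ≤ B := by
  have hcast : (((x 0).natAbs : ℕ) : ℝ) = |(x 0 : ℝ)| := by
    rw [Nat.cast_natAbs, Int.cast_abs]
  refine ⟨(x 0).natAbs, ?_, ?_, ?_⟩
  · have : (1 : ℝ) ≤ ((x 0).natAbs : ℕ) := by rw [hcast]; exact h1
    exact_mod_cast this
  · rw [hcast]; exact h2
  · apply Finset.sup'_le
    intro j hj
    have hj' := Finset.mem_range.1 hj
    have key : ∀ z : ℤ, |(x 0 : ℝ) * ξ ^ j - z| ≤ B →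
        |(((x 0).natAbs : ℕ) : ℝ) * ξ ^ j - approxSeq ξ (x 0).natAbs j| ≤ B := by
      intro z hz
      rw [hcast]
      rcases abs_choice (x 0 : ℝ) with h | h
      · refine le_trans ?_ hz
        have := round_le ((((x 0).natAbs : ℕ) : ℝ) * ξ ^ j) z
        rw [hcast, h] at this
        rw [h, approxSeq, hcast, h]
        exact this
      · refine le_trans ?_ hz
        have := round_le ((((x 0).natAbs : ℕ) : ℝ) * ξ ^ j) (-z)
        rw [hcast, h] at this
        rw [h, approxSeq, hcast, h]
        refine this.trans (le_of_eq ?_)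
        rw [← abs_neg]
        congr 1
        push_cast
        ring
    rcases Nat.eq_zero_or_pos j with rfl | hpos
    · apply key (x 0)
      simp [hB.le]
    · apply key (x (Fin.succ ⟨j - 1, by omega⟩))
      have := h3 ⟨j - 1, by omega⟩
      simp only at this
      rw [Nat.sub_add_cancel hpos] at this
      exact this.le

/-- The uniform hypothesis is used at `Q = q_{i+1} - 1`: no denominator below the next record
improves on `q_i`. Replacing `q_{i+1} - 1` by `q_{i+1}` costs the factor `2 ^ lam`. -/
theorem exists_isRecordSeq {ξ : ℝ} (hξ : Irrational ξ) {n : ℕ} (hn : 1 ≤ n) {lam : ℝ} (hlam : 0 < lam)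
    (h : ∀ᶠ Q : ℝ in atTop, ∃ x : Fin (n + 1) → ℤ,
      1 ≤ |(x 0 : ℝ)| ∧ |(x 0 : ℝ)| ≤ Q ∧
      ∀ i : Fin n, |(x 0 : ℝ) * ξ ^ ((i : ℕ) + 1) - (x i.succ : ℝ)| < Q ^ (-lam)) :
    ∃ C q, 0 < C ∧ IsRecordSeq ξ n lam C q := by
  obtain ⟨Q₀, hQ₀⟩ := eventually_atTop.1 h
  have hQ : ∀ Q : ℝ, Q₀ ≤ Q → 0 < Q → ∃ q : ℕ, 1 ≤ q ∧ (q : ℝ) ≤ Q ∧ approxErr ξ n q ≤ Q ^ (-lam) := by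
    intro Q h1 h2
    obtain ⟨x, hx1, hx2, hx3⟩ := hQ₀ Q h1
    exact approxErr_le_of_forall (Real.rpow_pos_of_pos h2 _) hx1 hx2 hx3
  obtain ⟨q, hq1, hq2, hq3, hq4⟩ := exists_strict_records (L := approxErr ξ n)
    (fun q hq => approxErr_pos hξ hn hq) (by
      intro ε hε
      have ht : Tendsto (fun Q : ℝ => Q ^ (-lam)) atTop (nhds 0) := tendsto_rpow_neg_atTop hlam
      obtain ⟨Q, h1, h2, h3⟩ := ((ht.eventually (gt_mem_nhds hε)).and
        ((eventually_ge_atTop Q₀).and (eventually_gt_atTop 0))).exists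
      obtain ⟨q, h4, _, h5⟩ := hQ Q h2 h3
      exact ⟨q, h4, h5.trans_lt h1⟩)
  obtain ⟨N, hN⟩ := exists_nat_gt (Q₀ + 1)
  -- The index shift ensures that `q_{i+1} - 1` is at least `Q₀` and at least half of `q_{i+1}`.
  refine ⟨2 ^ lam, fun i => q (i + N + 1), by positivity, ?_, fun i => hq2 _, ?_, ?_⟩
  · intro i j hij; exact hq1 (by omega)
  · intro i j hij; exact hq3 (by omega : i + N + 1 < j + N + 1)
  · intro i
    have hge : ((i + 1 + N + 1 : ℕ) : ℝ) ≤ q (i + 1 + N + 1) := by exact_mod_cast hq1.id_le _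
    push_cast at hge
    set r : ℝ := (q (i + 1 + N + 1) : ℝ) with hr
    have hi : (0 : ℝ) ≤ i := Nat.cast_nonneg i
    have hN0 : (0 : ℝ) ≤ N := Nat.cast_nonneg N
    obtain ⟨q', h1, h2, h3⟩ := hQ (r - 1) (by linarith) (by linarith)
    have h4 : q' < q (i + 1 + N + 1) := by
      have : (q' : ℝ) < q (i + 1 + N + 1) := by rw [← hr]; linarith
      exact_mod_cast this
    have h5 := hq4 (i + N + 1) q' h1 (by
      have : i + N + 1 + 1 = i + 1 + N + 1 := by omega
      rw [this]; exact h4)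
    show approxErr ξ n (q (i + N + 1)) ≤ 2 ^ lam * r ^ (-lam)
    refine h5.trans (h3.trans ?_)
    have h6 : (2 : ℝ) ^ lam * r ^ (-lam) = (r / 2) ^ (-lam) := by
      rw [Real.div_rpow (by linarith) (by norm_num), Real.rpow_neg (by norm_num : (0 : ℝ) ≤ 2)]
      field_simp
    rw [h6]
    apply Real.rpow_le_rpow_of_nonpos (by linarith) (by linarith) (by linarith)

/-! ### Small values of integer polynomials. -/

/-- Evaluation at `ξ` on coefficient vectors. -/
def evalVec (ξ : ℝ) (N : ℕ) : (Fin N → ℝ) →ₗ[ℝ] ℝ := (leval ξ).comp (vecPoly ℝ N)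

theorem evalVec_apply (ξ : ℝ) (N : ℕ) (u : Fin N → ℝ) :
    evalVec ξ N u = (vecPoly ℝ N u).eval ξ := rfl

theorem evalVec_intCast (ξ : ℝ) (N : ℕ) (u : Fin N → ℤ) :
    evalVec ξ N (fun j => (u j : ℝ)) = aeval ξ (vecPoly ℤ N u) := by
  rw [aeval_eq_eval_map, vecPoly_map]; rfl

theorem pairingVec_intCast (y : ℕ → ℤ) (N s : ℕ) (u : Fin N → ℤ) :
    pairingVec (fun j => (y j : ℝ)) N s (fun j => (u j : ℝ)) =
      ((pairing y (vecPoly ℤ N u * X ^ s) : ℤ) : ℝ) := by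
  rw [intCast_pairing, Polynomial.map_mul, vecPoly_map, pairingVec_apply]
  simp

theorem abs_vecPoly_coeff_le {N : ℕ} {u : Fin N → ℝ} {R : ℝ} (hR : 0 ≤ R)
    (h : ∀ j, |u j| ≤ R) (j : ℕ) : |(vecPoly ℝ N u).coeff j| ≤ R := by
  rw [vecPoly_coeff]
  split_ifs
  · exact h _
  · simpa using hR

theorem abs_vecPoly_int_coeff_le {N : ℕ} {u : Fin N → ℤ} {R : ℝ} (hR : 0 ≤ R)
    (h : ∀ j, |(u j : ℝ)| ≤ R) (j : ℕ) : |((vecPoly ℤ N u).coeff j : ℝ)| ≤ R := by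
  rw [vecPoly_coeff]
  split_ifs
  · exact h _
  · simpa using hR

/-- Dirichlet's theorem on small values of integer polynomials. -/
theorem exists_small_value (ξ : ℝ) {a : ℕ} (ha : 1 ≤ a) :
    ∃ C : ℝ, 0 < C ∧ ∀ R : ℕ, 1 ≤ R → ∃ G : ℤ[X], G ≠ 0 ∧ G.natDegree ≤ a ∧
      (∀ j, |(G.coeff j : ℝ)| ≤ R) ∧ |aeval ξ G| ≤ C / (R : ℝ) ^ a := by
  have hΞ := one_le_powBound ξ a
  set K : ℝ := (a + 1) * powBound ξ a with hK
  have hKpos : 0 < K := by positivity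
  refine ⟨8 * K, by positivity, fun R hR => ?_⟩
  have hR1 : (1 : ℝ) ≤ R := by exact_mod_cast hR
  by_contra hcon
  push Not at hcon
  -- With `d = 0` each cell holds one vector. The constant `8 * K` leaves at most `R^(a+1)/4 + 2`
  -- cells, too few for `(R+1)^(a+1) ≥ 4` vectors.
  have hbox := box_card_le (N := a + 1) (κ := Unit) (W := ℝ) (fun _ => evalVec ξ (a + 1))
    (fun _ => K * R) (fun _ => 8 * K / (R : ℝ) ^ a) (fun _ => by positivity) R 0
    (fun _ u hu => by
      rw [evalVec_apply]
      exact abs_eval_le (vecPoly_natDegree_le u) le_rfl (abs_vecPoly_coeff_le (by positivity)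
        fun j => by rw [abs_of_nonneg (hu j).1]; exact (hu j).2))
    ⊥ (by simp) 0 (le_refl 0) (fun u hu1 hu2 => by
      have hu0 : u = 0 := by
        by_contra hne
        have hP : vecPoly ℤ (a + 1) u ≠ 0 := fun h0 =>
          hne (vecPoly_injective _ (by rw [h0, map_zero]))
        have h1 := hcon _ hP (vecPoly_natDegree_le u)
          (abs_vecPoly_int_coeff_le (by positivity) hu1)
        have h2 := hu2 ()
        rw [evalVec_intCast] at h2
        linarith
      subst hu0
      refine ⟨?_, by simp, fun h => absurd rfl h⟩
      rw [Submodule.mem_bot]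
      ext j; simp)
  simp only [Finset.univ_unique, Finset.prod_singleton, pow_zero, mul_one] at hbox
  have h1 : 2 * (K * R) / (8 * K / (R : ℝ) ^ a) = (R : ℝ) ^ (a + 1) / 4 := by
    rw [pow_succ]; field_simp; ring
  rw [h1] at hbox
  have h2 : (R : ℝ) ^ (a + 1) ≤ (R + 1) ^ (a + 1) := by gcongr; linarith
  have h3 : (2 : ℝ) ^ 2 ≤ (R + 1) ^ (a + 1) :=
    calc (2 : ℝ) ^ 2 ≤ 2 ^ (a + 1) := pow_le_pow_right₀ (by norm_num) (by omega)
      _ ≤ _ := by gcongr; linarith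
  linarith

/-- If the values of integer polynomials of degree at most `k` at `ξ` are not too small, then the
polynomials of height `T ^ (1 + w - k)` with value `T ^ (-k)` span: they are not all killed by a
nonzero functional. -/
theorem exists_small_value_pairing_ne_zero {ξ : ℝ} {k : ℕ} {w : ℝ} (hw : k ≤ w)
    (h : ∃ Q₀ : ℝ, ∀ Q, Q₀ ≤ Q → ∀ P : ℤ[X], P.natDegree ≤ k → (∀ j, |(P.coeff j : ℝ)| ≤ Q) →
      P ≠ 0 → Q ^ (-w) < |aeval ξ P|) :
    ∃ C T₀ : ℝ, 1 ≤ C ∧ 1 ≤ T₀ ∧ ∀ T, T₀ ≤ T → ∀ z : ℕ → ℤ, (∃ j ≤ k, z j ≠ 0) →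
      ∃ P : ℤ[X], P.natDegree ≤ k ∧ (∀ j, |(P.coeff j : ℝ)| ≤ C * T ^ (1 + w - k)) ∧
        |aeval ξ P| ≤ C * T ^ (-(k : ℝ)) ∧ pairing z P ≠ 0 := by
  obtain ⟨Q₀, hQ₀⟩ := h
  have hΞ := one_le_powBound ξ k
  set K : ℝ := (k + 1) * powBound ξ k with hK
  have hK1 : 1 ≤ K := by
    rw [hK]; exact one_le_mul_of_one_le_of_one_le (by linarith [(Nat.cast_nonneg k : (0:ℝ) ≤ k)]) hΞ
  -- In the final box inequality the powers of `T` cancel, while `C` has exponent `k + 1` on the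
  -- left and `k` on the right. Any `C > 4 * K * 3 ^ k` gives a contradiction.
  set C : ℝ := 4 * K * 3 ^ k + 1 with hC
  have hC1 : 1 ≤ C := by
    have : 0 ≤ 4 * K * 3 ^ k := by positivity
    linarith
  refine ⟨C, max 1 Q₀, hC1, le_max_left _ _, fun T hT z ⟨j₀, hj₀, hzj⟩ => ?_⟩
  have hT1 : 1 ≤ T := (le_max_left _ _).trans hT
  have hTQ : Q₀ ≤ T := (le_max_right _ _).trans hT
  have hT0 : 0 < T := by linarith
  by_contra hcon
  push Not at hcon
  set s : ℝ := 1 + w - k with hs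
  have hs1 : 1 ≤ s := by linarith
  set R : ℕ := ⌊C * T ^ s⌋₊ with hR
  have hRle : (R : ℝ) ≤ C * T ^ s := Nat.floor_le (by positivity)
  have hRlt : C * T ^ s < R + 1 := Nat.lt_floor_add_one _
  set ψ : (Fin (k + 1) → ℝ) →ₗ[ℝ] ℝ := pairingVec (fun j => (z j : ℝ)) (k + 1) 0 with hψ
  have hψ0 : ψ ≠ 0 := by
    intro h0
    obtain ⟨u, hu⟩ := exists_vecPoly_eq (R := ℝ) (a := k) (F := X ^ j₀)
      ((natDegree_X_pow_le j₀).trans hj₀)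
    have := LinearMap.congr_fun h0 u
    rw [hψ, pairingVec_apply, hu, pow_zero, mul_one, pairing_X_pow, LinearMap.zero_apply] at this
    exact hzj (by exact_mod_cast this)
  have hψk : Module.finrank ℝ (LinearMap.ker ψ) ≤ k := by
    have h1 := LinearMap.finrank_range_add_finrank_ker ψ
    rw [Module.finrank_fin_fun, LinearMap.range_eq_top.2 (LinearMap.surjective hψ0),
      finrank_top, Module.finrank_self] at h1
    omega
  -- The open unit ball pulls back to height below `T` and value below `T ^ (-w)`, where the
  -- hypothesis allows no nonzero integer polynomial. This plays the role of Minkowski's second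
  -- theorem: a first minimum of at least `1` bounds the last one.
  set σ : (Fin (k + 1) → ℝ) →ₗ[ℝ] (Fin (k + 1) → ℝ) × ℝ :=
    (T⁻¹ • LinearMap.id).prod (T ^ w • evalVec ξ (k + 1)) with hσ
  have hr0 : 0 ≤ C * T ^ (s - 1) := by positivity
  have hbox := box_card_le (N := k + 1) (κ := Unit) (fun _ => evalVec ξ (k + 1))
    (fun _ => K * R) (fun _ => C * T ^ (-(k : ℝ))) (fun _ => by positivity) R k
    (fun _ u hu => by
      rw [evalVec_apply]
      exact abs_eval_le (vecPoly_natDegree_le u) le_rfl (abs_vecPoly_coeff_le (by positivity)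
        fun j => by rw [abs_of_nonneg (hu j).1]; exact (hu j).2))
    (LinearMap.ker ψ) hψk σ hr0 (fun u hu1 hu2 => by
      have hval := hu2 ()
      rw [evalVec_intCast] at hval
      refine ⟨?_, ?_, fun hne => ?_⟩
      · rw [LinearMap.mem_ker, hψ, pairingVec_intCast, pow_zero, mul_one]
        rw [hcon _ (vecPoly_natDegree_le u) (fun j => (abs_vecPoly_int_coeff_le (by positivity)
          hu1 j).trans hRle) hval.le]
        simp
      · rw [hσ, LinearMap.prod_apply, Prod.norm_def]
        apply max_le
        · rw [pi_norm_le_iff_of_nonneg hr0]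
          intro j
          change |T⁻¹ * (u j : ℝ)| ≤ _
          rw [abs_mul, abs_inv, abs_of_pos hT0]
          rw [inv_mul_le_iff₀ hT0]
          calc |(u j : ℝ)| ≤ C * T ^ s := (hu1 j).trans hRle
            _ = T * (C * T ^ (s - 1)) := by
              rw [Real.rpow_sub hT0 s 1, Real.rpow_one]; field_simp
        · change |T ^ w * evalVec ξ (k + 1) fun j => (u j : ℝ)| ≤ _
          rw [evalVec_intCast, abs_mul, abs_of_pos (Real.rpow_pos_of_pos hT0 w)]
          calc T ^ w * |aeval ξ (vecPoly ℤ (k + 1) u)| ≤ T ^ w * (C * T ^ (-(k : ℝ))) := by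
                gcongr
            _ = C * (T ^ w * T ^ (-(k : ℝ))) := by ring
            _ = C * T ^ (s - 1) := by
                rw [← Real.rpow_add hT0]; congr 2; rw [hs]; ring
      · by_contra hlt
        rw [not_le, hσ, LinearMap.prod_apply, Prod.norm_def, max_lt_iff] at hlt
        obtain ⟨h1, h2⟩ := hlt
        rw [pi_norm_lt_iff one_pos] at h1
        have hP : vecPoly ℤ (k + 1) u ≠ 0 := fun h0 =>
          hne (vecPoly_injective _ (by rw [h0, map_zero]))
        have h3 := hQ₀ T hTQ _ (vecPoly_natDegree_le u)
          (abs_vecPoly_int_coeff_le (u := u) hT0.le fun j => by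
            have : |T⁻¹ * (u j : ℝ)| < 1 := h1 j
            rw [abs_mul, abs_inv, abs_of_pos hT0, inv_mul_lt_iff₀ hT0, mul_one] at this
            exact this.le) hP
        change |T ^ w * evalVec ξ (k + 1) fun j => (u j : ℝ)| < 1 at h2
        rw [evalVec_intCast, abs_mul, abs_of_pos (Real.rpow_pos_of_pos hT0 w)] at h2
        rw [Real.rpow_neg hT0.le, inv_lt_iff_one_lt_mul₀ (Real.rpow_pos_of_pos hT0 w)] at h3
        linarith)
  simp only [Finset.univ_unique, Finset.prod_singleton] at hbox
  have hTk : 0 < T ^ (k : ℝ) := Real.rpow_pos_of_pos hT0 _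
  have hTs : 1 ≤ T ^ s := Real.one_le_rpow hT1 (by linarith)
  have hTs1 : 1 ≤ T ^ (s - 1) := Real.one_le_rpow hT1 (by linarith)
  have h1 : 2 * (K * R) / (C * T ^ (-(k : ℝ))) + 2 ≤ 4 * K * (T ^ s * T ^ (k : ℝ)) := by
    have h2 : 2 * (K * R) / (C * T ^ (-(k : ℝ))) ≤ 2 * K * (T ^ s * T ^ (k : ℝ)) := by
      rw [div_le_iff₀ (by positivity), Real.rpow_neg hT0.le]
      calc 2 * (K * R) ≤ 2 * (K * (C * T ^ s)) := by gcongr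
        _ = _ := by field_simp
    have h3 : 1 ≤ K * (T ^ s * T ^ (k : ℝ)) :=
      one_le_mul_of_one_le_of_one_le hK1
        (one_le_mul_of_one_le_of_one_le hTs (Real.one_le_rpow hT1 (by positivity)))
    linarith
  have h2 : 2 * (C * T ^ (s - 1)) + 1 ≤ 3 * C * T ^ (s - 1) := by
    have := one_le_mul_of_one_le_of_one_le hC1 hTs1
    linarith
  have h3 : (C * T ^ s) ^ (k + 1) ≤ 4 * K * (T ^ s * T ^ (k : ℝ)) * (3 * C * T ^ (s - 1)) ^ k :=
    calc (C * T ^ s) ^ (k + 1) ≤ ((R : ℝ) + 1) ^ (k + 1) := by gcongr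
      _ ≤ _ := hbox
      _ ≤ _ := by gcongr
  have h4 : 4 * K * (T ^ s * T ^ (k : ℝ)) * (3 * C * T ^ (s - 1)) ^ k =
      4 * K * 3 ^ k * (C ^ k * (T ^ s) ^ (k + 1)) := by
    have h5 : T ^ (s - 1) = T ^ s / T := by rw [Real.rpow_sub hT0 s 1, Real.rpow_one]
    rw [h5, Real.rpow_natCast, mul_pow, mul_pow, div_pow, pow_succ (T ^ s)]
    field_simp
  rw [h4, mul_pow, pow_succ C] at h3
  have h5 : 0 < C ^ k * (T ^ s) ^ (k + 1) := by positivity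
  have h6 : C * (C ^ k * (T ^ s) ^ (k + 1)) ≤ 4 * K * 3 ^ k * (C ^ k * (T ^ s) ^ (k + 1)) := by
    linarith
  have h7 := le_of_mul_le_mul_right h6 h5
  linarith

theorem aeval_ne_zero_of_transcendental {ξ : ℝ} (hξ : Transcendental ℚ ξ) {G : ℤ[X]} (hG : G ≠ 0) :
    aeval ξ G ≠ 0 := by
  rw [transcendental_iff] at hξ
  intro h0
  have h1 := hξ (G.map (algebraMap ℤ ℚ)) (by rwa [aeval_map_algebraMap])
  exact hG ((Polynomial.map_eq_zero_iff (algebraMap ℤ ℚ).injective_int).1 h1)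

/-- Dirichlet's theorem reaches every exponent below `k`; transcendence makes the values nonzero. -/
theorem le_dualExponent {ξ : ℝ} (hξ : Transcendental ℚ ξ) {k : ℕ} (hk : 1 ≤ k) :
    (k : EReal) ≤ dualExponent k ξ := by
  obtain ⟨C, hC, hex⟩ := exists_small_value ξ hk
  apply le_of_forall_lt
  intro c hc
  obtain ⟨w, hcw, hwk⟩ := EReal.lt_iff_exists_real_btwn.1 hc
  refine hcw.trans_le (le_sSup ⟨w, ?_, rfl⟩)
  have hwk' : w < k := by exact_mod_cast hwk
  have ht : Tendsto (fun R : ℕ => (R : ℝ) ^ ((k : ℝ) - w)) atTop atTop :=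
    (tendsto_rpow_atTop (by linarith)).comp tendsto_natCast_atTop_atTop
  have hfreq : ∀ᶠ R : ℕ in atTop, ∃ P : ℤ[X],
      P.natDegree ≤ k ∧ (∀ j : ℕ, |(P.coeff j : ℝ)| ≤ R) ∧
      0 < |aeval ξ P| ∧ |aeval ξ P| ≤ (R : ℝ) ^ (-w) := by
    filter_upwards [ht.eventually_ge_atTop C, eventually_ge_atTop 1] with R h1 h2
    obtain ⟨G, hG0, hG1, hG2, hG3⟩ := hex R h2
    have hR0 : (0 : ℝ) < R := by exact_mod_cast h2
    refine ⟨G, hG1, hG2, ?_, hG3.trans ?_⟩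
    · rw [abs_pos]
      exact aeval_ne_zero_of_transcendental hξ hG0
    · rw [div_le_iff₀ (by positivity), ← Real.rpow_natCast, ← Real.rpow_add hR0]
      convert h1 using 2
      ring
  exact tendsto_natCast_atTop_atTop.frequently hfreq.frequently

/-! ### Bounds for errors and for heights of recurrences by the box principle. -/

section

variable {ξ : ℝ} {n : ℕ}

/-- The constant that controls the values of shifted polynomials at the approximation sequences. -/
def shiftBound (ξ : ℝ) (n : ℕ) : ℝ := (n + 1) * (powBound ξ n + 1)

theorem one_le_shiftBound (ξ : ℝ) (n : ℕ) : 1 ≤ shiftBound ξ n :=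
  one_le_mul_of_one_le_of_one_le (by linarith [(Nat.cast_nonneg n : (0 : ℝ) ≤ n)])
    (by linarith [one_le_powBound ξ n])

/-- The subtracted multiple cancels the main term `q' ξ^s F(ξ)`. Among the functionals of a box
argument only the unshifted pairing then has size `q`; the others have the size of the errors. -/
theorem abs_pairing_sub_mul_pairing_le {F : ℝ[X]} {R : ℝ} {a s q q' : ℕ} (hq : 1 ≤ q) (hqq : q' ≤ q)
    (hL : approxErr ξ n q ≤ approxErr ξ n q') (hF : F.natDegree ≤ a) (ha : a + s ≤ n)
    (hR : ∀ j, |F.coeff j| ≤ R) :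
    |pairing (fun j => (approxSeq ξ q' j : ℝ)) (F * X ^ s) -
      q' / q * ξ ^ s * pairing (fun j => (approxSeq ξ q j : ℝ)) F| ≤
      shiftBound ξ n * R * approxErr ξ n q' := by
  have hR0 : 0 ≤ R := (abs_nonneg _).trans (hR 0)
  have hΞ := one_le_powBound ξ n
  have hL0 := approxErr_nonneg (ξ := ξ) (n := n) q
  have hq0 : (0 : ℝ) < q := by exact_mod_cast hq
  have hqq' : (q' : ℝ) / q ≤ 1 := by
    rw [div_le_one hq0]; exact_mod_cast hqq
  have h1 := abs_pairing_sub_le (ξ := ξ) (n := n) q' hF ha hR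
  have h2 := abs_pairing_sub_le (ξ := ξ) (n := n) (s := 0) q hF (by omega) hR
  rw [pow_zero, mul_one, pow_zero, mul_one] at h2
  have h3 : |(q' : ℝ) / q * ξ ^ s *
      (pairing (fun j => (approxSeq ξ q j : ℝ)) F - q * F.eval ξ)| ≤
      powBound ξ n * ((n + 1) * R * approxErr ξ n q') := by
    rw [abs_mul, abs_mul, abs_of_nonneg (by positivity : (0 : ℝ) ≤ q' / q)]
    have h4 := abs_pow_le_powBound ξ (n := n) (j := s) (by omega)
    have h5 : (q' : ℝ) / q * |ξ ^ s| ≤ powBound ξ n := by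
      calc _ ≤ 1 * powBound ξ n := by gcongr
        _ = _ := one_mul _
    refine mul_le_mul h5 (h2.trans ?_) (abs_nonneg _) (by linarith)
    gcongr
  calc _ = |(pairing (fun j => (approxSeq ξ q' j : ℝ)) (F * X ^ s) - q' * ξ ^ s * F.eval ξ) -
        (q' : ℝ) / q * ξ ^ s *
          (pairing (fun j => (approxSeq ξ q j : ℝ)) F - q * F.eval ξ)| := by
        congr 1; field_simp; ring
    _ ≤ _ := abs_sub _ _
    _ ≤ (n + 1) * R * approxErr ξ n q' + powBound ξ n * ((n + 1) * R * approxErr ξ n q') :=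
        add_le_add h1 h3
    _ = _ := by rw [shiftBound]; ring

theorem abs_pairing_le {F : ℝ[X]} {R : ℝ} {a q : ℕ} (hq : 1 ≤ q) (hF : F.natDegree ≤ a) (ha : a ≤ n)
    (hR : ∀ j, |F.coeff j| ≤ R) :
    |pairing (fun j => (approxSeq ξ q j : ℝ)) F| ≤ shiftBound ξ n * q * R := by
  have hR0 : 0 ≤ R := (abs_nonneg _).trans (hR 0)
  have hq1 : (1 : ℝ) ≤ q := by exact_mod_cast hq
  have h1 := abs_pairing_sub_le (ξ := ξ) (n := n) (s := 0) q hF (by omega) hR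
  rw [pow_zero, mul_one, pow_zero, mul_one] at h1
  have h2 := abs_eval_le (ξ := ξ) hF ha hR
  have h3 := abs_add_le (pairing (fun j => (approxSeq ξ q j : ℝ)) F - q * F.eval ξ) (q * F.eval ξ)
  rw [sub_add_cancel] at h3
  calc _ ≤ _ := h3
    _ ≤ (n + 1) * R * q + q * ((n + 1) * powBound ξ n * R) := by
        rw [abs_mul, Nat.abs_cast]
        gcongr
        exact h1.trans (by gcongr; exact (approxErr_le_one q).trans hq1)
    _ = _ := by rw [shiftBound]; ring

theorem abs_vecPoly_coeff_le_of_mem_box {N R : ℕ} {u : Fin N → ℝ} (hu : ∀ j, 0 ≤ u j ∧ u j ≤ R)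
    (j : ℕ) : |(vecPoly ℝ N u).coeff j| ≤ R :=
  abs_vecPoly_coeff_le (Nat.cast_nonneg R)
    (fun j => by rw [abs_of_nonneg (hu j).1]; exact (hu j).2) j

/-- The functional whose smallness forces a polynomial to be orthogonal to a shift of an
approximation sequence, once it is orthogonal to another approximation sequence. -/
def shiftVec (ξ : ℝ) (q q' N s : ℕ) : (Fin N → ℝ) →ₗ[ℝ] ℝ :=
  pairingVec (fun j => (approxSeq ξ q' j : ℝ)) N s -
    ((q' : ℝ) / q * ξ ^ s) • pairingVec (fun j => (approxSeq ξ q j : ℝ)) N 0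

theorem shiftVec_apply (ξ : ℝ) (q q' N s : ℕ) (u : Fin N → ℝ) : shiftVec ξ q q' N s u =
    pairing (fun j => (approxSeq ξ q' j : ℝ)) (vecPoly ℝ N u * X ^ s) -
      (q' : ℝ) / q * ξ ^ s * pairing (fun j => (approxSeq ξ q j : ℝ)) (vecPoly ℝ N u) := by
  simp [shiftVec, pairingVec_apply]

theorem pairing_eq_zero_of_shiftVec {q q' N s : ℕ} {u : Fin N → ℤ}
    (h0 : pairing (approxSeq ξ q) (vecPoly ℤ N u) = 0)
    (h : |shiftVec ξ q q' N s fun j => (u j : ℝ)| < 1) :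
    pairing (approxSeq ξ q') (vecPoly ℤ N u * X ^ s) = 0 := by
  apply intCast_eq_zero_of_abs_lt_one
  rw [shiftVec, LinearMap.sub_apply, LinearMap.smul_apply, pairingVec_intCast,
    pairingVec_intCast, pow_zero, mul_one, h0, Int.cast_zero, smul_zero, sub_zero] at h
  exact h

theorem pairing_eq_zero_of_pairingVec {q N : ℕ} {u : Fin N → ℤ}
    (h : |pairingVec (fun j => (approxSeq ξ q j : ℝ)) N 0 fun j => (u j : ℝ)| < 1) :
    pairing (approxSeq ξ q) (vecPoly ℤ N u) = 0 := by
  apply intCast_eq_zero_of_abs_lt_one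
  rw [pairingVec_intCast, pow_zero, mul_one] at h
  exact h

/-- An approximation without recurrence of formal degree `a` is not too good. -/
theorem one_le_mul_pow_of_annih_eq_bot {a q : ℕ} (hq : 1 ≤ q) (ha : a ≤ n)
    (hL : 0 < approxErr ξ n q) (h : annih (approxSeq ξ q) n a = ⊥) :
    1 ≤ 4 * shiftBound ξ n * (2 * shiftBound ξ n) ^ a * (q * approxErr ξ n q ^ a) := by
  have hK := one_le_shiftBound ξ n
  set K := shiftBound ξ n with hKdef
  set L := approxErr ξ n q with hLdef
  -- This size gives `K * R * L < 1`, so the vanishing of the unshifted pairing forces all shifted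
  -- ones to vanish.
  set R : ℕ := ⌊1 / (2 * K * L)⌋₊ with hR
  have hq1 : (1 : ℝ) ≤ q := by exact_mod_cast hq
  have hRle : (R : ℝ) ≤ 1 / (2 * K * L) := Nat.floor_le (by positivity)
  have hRlt : 1 / (2 * K * L) < R + 1 := Nat.lt_floor_add_one _
  have hRL : K * R * L < 1 := by
    calc K * R * L ≤ K * (1 / (2 * K * L)) * L := by gcongr
      _ = 1 / 2 := by field_simp
      _ < 1 := by norm_num
  have hbox := box_card_le (N := a + 1) (κ := Unit) (W := ℝ)
    (fun _ => pairingVec (fun j => (approxSeq ξ q j : ℝ)) (a + 1) 0)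
    (fun _ => K * q * R) (fun _ => 1) (fun _ => one_pos) R 0
    (fun _ u hu => by
      rw [pairingVec_apply, pow_zero, mul_one]
      exact abs_pairing_le hq (vecPoly_natDegree_le u) ha (abs_vecPoly_coeff_le_of_mem_box hu))
    ⊥ (by simp) 0 (le_refl 0) (fun u hu1 hu2 => by
      have h0 := pairing_eq_zero_of_pairingVec (hu2 ())
      have hmem : vecPoly ℤ (a + 1) u ∈ annih (approxSeq ξ q) n a := by
        refine ⟨vecPoly_natDegree_le u, fun s hs => pairing_eq_zero_of_shiftVec h0 ?_⟩
        rw [shiftVec_apply]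
        exact (abs_pairing_sub_mul_pairing_le hq le_rfl le_rfl (vecPoly_natDegree_le _) hs
          (abs_vecPoly_coeff_le (by positivity) hu1)).trans_lt hRL
      rw [h, Submodule.mem_bot] at hmem
      have hu0 : u = 0 := vecPoly_injective _ (by rw [hmem, map_zero])
      subst hu0
      refine ⟨?_, by simp, fun h => absurd rfl h⟩
      rw [Submodule.mem_bot]
      ext j; simp)
  simp only [Finset.univ_unique, Finset.prod_singleton, pow_zero, mul_one, div_one] at hbox
  have h1 : ((R : ℝ) + 1) ^ a ≤ 4 * K * q := by
    have h2 : ((R : ℝ) + 1) ^ a * (R + 1) ≤ 4 * K * q * (R + 1) := by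
      rw [← pow_succ]
      have h3 : 1 ≤ K * q := one_le_mul_of_one_le_of_one_le hK hq1
      have h4 : 0 ≤ K * q * R := by positivity
      linarith
    exact le_of_mul_le_mul_right h2 (by positivity)
  have h2 : (1 / (2 * K * L)) ^ a ≤ 4 * K * q := le_trans (by gcongr) h1
  rw [div_pow, one_pow, div_le_iff₀ (by positivity), mul_pow] at h2
  linarith

/-- The recurrences of formal degree `n - m` of an approximation cannot all be large. -/
theorem height_pow_le {m D q q' s A : ℕ} (hn : m + (m + 1 + D) = n) (hq : 1 ≤ q) (hqq : q' ≤ q)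
    (hL : approxErr ξ n q ≤ approxErr ξ n q') (hpos : 0 < approxErr ξ n q) (hs : s ≤ m)
    (hbot : annih (fun j => (approxSeq ξ q j : ℚ)) n m = ⊥) {G : ℤ[X]}
    (hG : G ∈ annih (approxSeq ξ q) n (m + 1 + D))
    (hGs : pairing (approxSeq ξ q') (G * X ^ s) ≠ 0) (hA1 : 1 ≤ A)
    (hA : ∀ F ∈ annih (approxSeq ξ q) n (m + 1 + D), F ≠ 0 → A ≤ height F) :
    (A : ℝ) ^ D ≤ (4 * shiftBound ξ n) ^ (m + 2) * 3 ^ D *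
      (q * approxErr ξ n q ^ m * approxErr ξ n q') := by
  have hK := one_le_shiftBound ξ n
  set K := shiftBound ξ n with hKdef
  set L := approxErr ξ n q with hLdef
  set L' := approxErr ξ n q' with hLdef'
  have hpos' : 0 < L' := hpos.trans_le hL
  set b := m + 1 + D with hb
  have hq1 : (1 : ℝ) ≤ q := by exact_mod_cast hq
  have hA1' : (1 : ℝ) ≤ A := by exact_mod_cast hA1
  -- The recurrences of formal degree `b` have dimension `(b + 1) - (m + 1) = D + 1`. Since `G` is
  -- not orthogonal to the shift `s` of the other sequence, imposing that condition leaves dimension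
  -- `D`.
  set V : Submodule ℚ (Fin (b + 1) → ℚ) := LinearMap.ker (LinearMap.pi fun j : Fin (m + 1) =>
      pairingVec (fun j => (approxSeq ξ q j : ℚ)) (b + 1) (j : ℕ)) ⊓
      LinearMap.ker (pairingVec (fun j => (approxSeq ξ q' j : ℚ)) (b + 1) s) with hV
  have hVd : Module.finrank ℚ V ≤ D := by
    refine finrank_le_of_annih hn hb.symm hbot (G := G.map (Int.castRingHom ℚ)) ?_ ?_
    · exact (mem_annih_map_iff (f := Int.castRingHom ℚ) Int.cast_injective _ n b G).2 hG
    · have h1 := pairing_map (Int.castRingHom ℚ) (approxSeq ξ q') (G * X ^ s)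
      rw [Polynomial.map_mul, Polynomial.map_pow, map_X] at h1
      refine fun h2 => hGs ?_
      have h3 := h1.symm.trans h2
      rwa [eq_intCast, Int.cast_eq_zero] at h3
  obtain ⟨E, hE, hEV⟩ := exists_real_submodule V
  -- Only a large `R` is needed: its exponents on the two sides agree, as `1 + 1 + m + D = b + 1`.
  obtain ⟨R, hR⟩ := exists_nat_ge (max (1 / L) A)
  have hRL : 1 ≤ R * L := by
    have := (le_max_left _ _).trans hR
    rwa [div_le_iff₀ hpos] at this
  have hRA : (A : ℝ) ≤ R := (le_max_right _ _).trans hR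
  have hR1 : (1 : ℝ) ≤ R := hA1'.trans hRA
  have hRL' : 1 ≤ R * L' := hRL.trans (by gcongr)
  have hbox := box_card_le (N := b + 1) (κ := Option (Option (Fin m)))
    (fun t => t.elim (pairingVec (fun j => (approxSeq ξ q j : ℝ)) (b + 1) 0) fun t' =>
      t'.elim (shiftVec ξ q q' (b + 1) s) fun j => shiftVec ξ q q (b + 1) (j + 1))
    (fun t => t.elim (K * q * R) fun t' => t'.elim (K * R * L') fun _ => K * R * L)
    (fun _ => 1) (fun _ => one_pos) R D
    (fun t u hu => by
      have hu' := abs_vecPoly_coeff_le_of_mem_box hu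
      rcases t with _ | _ | j
      · change |pairingVec _ (b + 1) 0 u| ≤ _
        rw [pairingVec_apply, pow_zero, mul_one]
        exact abs_pairing_le hq (vecPoly_natDegree_le u) (by omega) hu'
      · change |shiftVec ξ q q' (b + 1) s u| ≤ _
        rw [shiftVec_apply]
        exact abs_pairing_sub_mul_pairing_le hq hqq hL (vecPoly_natDegree_le u) (by omega) hu'
      · change |shiftVec ξ q q (b + 1) (j + 1) u| ≤ _
        rw [shiftVec_apply]
        have := j.2
        exact abs_pairing_sub_mul_pairing_le hq le_rfl le_rfl (vecPoly_natDegree_le u)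
          (by omega) hu')
    E (hE.trans hVd) ((A : ℝ)⁻¹ • LinearMap.id) (r := R / A) (by positivity) (fun u hu1 hu2 => by
      have h0 : pairing (approxSeq ξ q) (vecPoly ℤ (b + 1) u) = 0 :=
        pairing_eq_zero_of_pairingVec (hu2 none)
      have h1 : pairing (approxSeq ξ q') (vecPoly ℤ (b + 1) u * X ^ s) = 0 :=
        pairing_eq_zero_of_shiftVec h0 (hu2 (some none))
      have hmem : vecPoly ℤ (b + 1) u ∈ annih (approxSeq ξ q) n b := by
        refine ⟨vecPoly_natDegree_le u, fun j hj => ?_⟩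
        rcases Nat.eq_zero_or_pos j with rfl | hj0
        · rwa [pow_zero, mul_one]
        · have h2 := hu2 (some (some ⟨j - 1, by omega⟩))
          have h3 : j - 1 + 1 = j := by omega
          refine pairing_eq_zero_of_shiftVec h0 (q := q) ?_
          rw [← h3]
          exact h2
      have hnorm : ∀ v : Fin (b + 1) → ℝ, ‖((A : ℝ)⁻¹ • LinearMap.id : _ →ₗ[ℝ] _) v‖ = ‖v‖ / A := by
        intro v
        rw [LinearMap.smul_apply, LinearMap.id_apply, norm_smul, norm_inv, Real.norm_natCast]
        field_simp
      refine ⟨?_, ?_, fun hne => ?_⟩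
      · have h4 : (fun j => (u j : ℚ)) ∈ V := by
          rw [hV, Submodule.mem_inf, mem_ker_pi_pairingVec hn, LinearMap.mem_ker]
          have h5 : vecPoly ℚ (b + 1) (fun j => (u j : ℚ)) =
              (vecPoly ℤ (b + 1) u).map (Int.castRingHom ℚ) := by rw [vecPoly_map]; rfl
          constructor
          · rw [h5]
            exact (mem_annih_map_iff (f := Int.castRingHom ℚ) Int.cast_injective _ n b _).2 hmem
          · rw [pairingVec_apply, h5]
            have h6 := pairing_map (Int.castRingHom ℚ) (approxSeq ξ q') (vecPoly ℤ (b + 1) u * X ^ s)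
            rw [Polynomial.map_mul, Polynomial.map_pow, map_X, h1, map_zero] at h6
            exact h6
        have h7 := hEV _ h4
        simpa using h7
      · rw [hnorm]
        gcongr
        rw [pi_norm_le_iff_of_nonneg (by positivity)]
        exact hu1
      · rw [hnorm, le_div_iff₀ (by linarith), one_mul]
        have hP : vecPoly ℤ (b + 1) u ≠ 0 := fun h0 =>
          hne (vecPoly_injective _ (by rw [h0, map_zero]))
        have h8 : (A : ℝ) ≤ height (vecPoly ℤ (b + 1) u) := by exact_mod_cast hA _ hmem hP
        refine h8.trans (height_le_of_abs_coeff_le (norm_nonneg _)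
          (abs_vecPoly_int_coeff_le (norm_nonneg _) fun j => ?_))
        exact norm_le_pi_norm (fun j => (u j : ℝ)) j)
  simp only [Fintype.prod_option, Option.elim_none, Option.elim_some, Finset.prod_const,
    Finset.card_univ, Fintype.card_fin, div_one] at hbox
  have h1 : 2 * (K * q * R) + 2 ≤ 4 * K * q * R := by
    have := one_le_mul_of_one_le_of_one_le (one_le_mul_of_one_le_of_one_le hK hq1) hR1
    linarith
  have h2 : 2 * (K * R * L') + 2 ≤ 4 * K * R * L' := by
    have := one_le_mul_of_one_le_of_one_le hK hRL'
    linarith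
  have h3 : 2 * (K * R * L) + 2 ≤ 4 * K * R * L := by
    have := one_le_mul_of_one_le_of_one_le hK hRL
    linarith
  have h4 : 2 * (R / A : ℝ) + 1 ≤ 3 * R / A := by
    have : 1 ≤ (R : ℝ) / A := (one_le_div (by linarith)).2 hRA
    rw [mul_div_assoc]
    linarith
  have h5 : (R : ℝ) ^ (b + 1) ≤
      (4 * K * q * R) * ((4 * K * R * L') * (4 * K * R * L) ^ m) * (3 * R / A) ^ D := by
    calc (R : ℝ) ^ (b + 1) ≤ ((R : ℝ) + 1) ^ (b + 1) := by gcongr; linarith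
      _ ≤ _ := hbox
      _ ≤ _ := by gcongr
  have h6 : (4 * K * q * R) * ((4 * K * R * L') * (4 * K * R * L) ^ m) * (3 * R / A) ^ D =
      (4 * K) ^ (m + 2) * 3 ^ D * (q * L ^ m * L') * R ^ (b + 1) / A ^ D := by
    rw [hb, div_pow, mul_pow, mul_pow, mul_pow]
    ring
  rw [h6, le_div_iff₀ (by positivity), mul_comm] at h5
  exact le_of_mul_le_mul_right h5 (by positivity)

end

/-! ### Primitive recurrences and the absence of recurrences of low degree. -/

/-- The height of a factor is bounded in terms of the height of the product. -/
theorem height_le_of_mul {Q W : ℤ[X]} {n : ℕ} (hW : W ≠ 0) (hn : (Q * W).natDegree ≤ n)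
    (hQ : Q ≠ 0) : (height Q : ℝ) ≤ 2 ^ n * (n + 1) * height (Q * W) := by
  refine height_le_of_abs_coeff_le (by positivity) fun j => ?_
  have hQn : Q.natDegree ≤ n := by
    rw [natDegree_mul hQ hW] at hn; omega
  -- The Mahler measure is multiplicative and at least `1` on nonzero integer polynomials, so the
  -- factor `W` cannot lower it.
  have h1 := norm_coeff_le_choose_mul_mahlerMeasure_of_one_le_mahlerMeasure j
    (Q.map (Int.castRingHom ℂ)) _ (one_le_mahlerMeasure_of_ne_zero hW)
  rw [← Polynomial.map_mul, natDegree_map_eq_of_injective (RingHom.injective_int _), coeff_map,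
    eq_intCast, Complex.norm_intCast] at h1
  have h2 : ((Q * W).map (Int.castRingHom ℂ)).mahlerMeasure ≤ (n + 1) * height (Q * W) := by
    refine (mahlerMeasure_le_sum_norm_coeff _).trans ?_
    rw [sum_over_range' _ (by simp) (n + 1) (Nat.lt_succ_of_le (natDegree_map_le.trans hn))]
    calc _ ≤ ∑ _j ∈ Finset.range (n + 1), (height (Q * W) : ℝ) := by
          refine Finset.sum_le_sum fun j _ => ?_
          rw [coeff_map, eq_intCast, Complex.norm_intCast]
          exact abs_coeff_le_height _ j
      _ = _ := by simp
  have h3 : ((Q.natDegree.choose j : ℕ) : ℝ) ≤ 2 ^ n := by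
    have h4 : Q.natDegree.choose j ≤ 2 ^ n :=
      (Nat.choose_le_two_pow _ _).trans (Nat.pow_le_pow_right (by norm_num) hQn)
    exact_mod_cast h4
  calc _ ≤ _ := h1
    _ ≤ 2 ^ n * ((n + 1) * height (Q * W)) := by gcongr; exact mahlerMeasure_nonneg _
    _ = _ := by ring

/-- Every rational recurrence is proportional to an integer one. -/
theorem exists_int_recurrence {y : ℕ → ℤ} {n a : ℕ} {F : ℚ[X]}
    (hF : F ∈ annih (fun j => (y j : ℚ)) n a) :
    ∃ P ∈ annih y n a, ∃ b : ℤ, b ≠ 0 ∧ P.map (Int.castRingHom ℚ) = (b : ℚ) • F := by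
  obtain ⟨b, hbM, hb⟩ := IsLocalization.integerNormalization_spec (nonZeroDivisors ℤ) F
  have hb' : (IsLocalization.integerNormalization (nonZeroDivisors ℤ) F).map (Int.castRingHom ℚ) =
      (b : ℚ) • F := by
    rw [← algebraMap_int_eq, hb, ← algebraMap_smul ℚ b F]; rfl
  refine ⟨_, ?_, b, nonZeroDivisors.ne_zero hbM, hb'⟩
  rw [← mem_annih_map_iff (f := Int.castRingHom ℚ) Int.cast_injective, hb']
  exact Submodule.smul_mem _ _ hF

theorem annih_rat_eq_bot {y : ℕ → ℤ} {n a : ℕ} (h : annih y n a = ⊥) :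
    annih (fun j => (y j : ℚ)) n a = ⊥ := by
  rw [Submodule.eq_bot_iff]
  intro F hF
  obtain ⟨P, hP, b, hb, hPF⟩ := exists_int_recurrence hF
  rw [h, Submodule.mem_bot] at hP
  rw [hP, Polynomial.map_zero] at hPF
  exact (smul_eq_zero.1 hPF.symm).resolve_left (by exact_mod_cast hb)

theorem annih_rat_le {y z : ℕ → ℤ} {n a : ℕ} (h : annih y n a ≤ annih z n a) :
    annih (fun j => (y j : ℚ)) n a ≤ annih (fun j => (z j : ℚ)) n a := by
  intro F hF
  obtain ⟨P, hP, b, hb, hPF⟩ := exists_int_recurrence hF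
  have h1 := (mem_annih_map_iff (f := Int.castRingHom ℚ) Int.cast_injective _ _ _ _).2 (h hP)
  rw [hPF] at h1
  exact (Submodule.smul_mem_iff _ (by exact_mod_cast hb)).1 h1

theorem primPart_mem_annih {y : ℕ → ℤ} {n a : ℕ} {F : ℤ[X]} (hF : F ∈ annih y n a) (hF0 : F ≠ 0) :
    F.primPart ∈ annih y n a := by
  refine ⟨by rw [natDegree_primPart]; exact hF.1, fun j hj => ?_⟩
  have h1 := hF.2 j hj
  rw [F.eq_C_content_mul_primPart, ← smul_eq_C_mul, smul_mul_assoc, map_smul, smul_eq_mul] at h1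
  exact (mul_eq_zero.1 h1).resolve_left fun h => hF0 (content_eq_zero_iff.1 h)

/-- If an integer sequence has a recurrence of formal degree at most `(n + 1) / 2`, there is a
primitive recurrence of minimal formal degree that divides the recurrences of all
formal degrees up to the complementary one. -/
theorem exists_primitive_recurrence {y : ℕ → ℤ} {n m : ℕ} (hn : 2 * m + 2 ≤ n) (hy : y 0 ≠ 0)
    (hne : annih y n (m + 1) ≠ ⊥) :
    ∃ Q : ℤ[X], Q ≠ 0 ∧ ∃ h ≤ m, Q ∈ annih y n (h + 1) ∧
      (∀ G ∈ annih y n (n - m), Q ∣ G) ∧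
      ∀ z : ℕ → ℤ, Q ∈ annih z n (h + 1) → annih y n (m + 1) ≤ annih z n (m + 1) := by
  classical
  have hex : ∃ a, annih y n a ≠ ⊥ := ⟨_, hne⟩
  have h0 : annih y n 0 = ⊥ := by
    rw [Submodule.eq_bot_iff]
    intro F hF
    have h1 := hF.2 0 (Nat.zero_le _)
    rw [eq_C_of_natDegree_eq_zero (Nat.le_zero.1 hF.1), pow_zero, mul_one, ← monomial_zero_left,
      pairing_monomial] at h1
    rw [eq_C_of_natDegree_eq_zero (Nat.le_zero.1 hF.1), (mul_eq_zero.1 h1).resolve_right hy, C_0]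
  obtain ⟨h, hh⟩ : ∃ h, Nat.find hex = h + 1 := by
    refine Nat.exists_eq_succ_of_ne_zero fun hc => ?_
    have h1 := Nat.find_spec hex
    rw [hc] at h1
    exact h1 h0
  have hhm : h ≤ m := by
    have := Nat.find_min' hex hne
    omega
  have hmin : annih y n h = ⊥ := by
    by_contra hc
    have := Nat.find_min' hex hc
    omega
  have hspec : annih y n (h + 1) ≠ ⊥ := hh ▸ Nat.find_spec hex
  obtain ⟨F, hF, hF0⟩ := Submodule.exists_mem_ne_zero_of_ne_bot hspec
  set Q := F.primPart with hQ
  have hQmem : Q ∈ annih y n (h + 1) := primPart_mem_annih hF hF0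
  have hQ0 : Q ≠ 0 := primPart_ne_zero F
  set f := Int.castRingHom ℚ with hf
  have hfi : Function.Injective f := Int.cast_injective
  have hQf : Q.map f ∈ annih (fun j => f (y j)) n (h + 1) := (mem_annih_map_iff hfi _ _ _ _).2 hQmem
  have hQf0 : Q.map f ≠ 0 := (Polynomial.map_ne_zero_iff hfi).2 hQ0
  have hfac : ∀ G ∈ annih (fun j => f (y j)) n (n - h),
      ∃ U : ℚ[X], U.natDegree ≤ n - 2 * h - 1 ∧ G = Q.map f * U := fun G hG =>
    exists_eq_mul_of_mem_annih (annih_rat_eq_bot hmin) (by omega) (by omega) hQf hQf0 hG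
  refine ⟨Q, hQ0, h, hhm, hQmem, fun G hG => ?_, fun z hz G hG => ?_⟩
  -- Gauss's lemma turns divisibility over `ℚ` into divisibility over `ℤ`.
  · rw [IsPrimitive.Int.dvd_iff_map_cast_dvd_map_cast _ _ F.isPrimitive_primPart]
    obtain ⟨U, _, hU⟩ := hfac (G.map f)
      ((mem_annih_map_iff hfi _ _ _ _).2 (annih_mono y n (by omega) hG))
    exact ⟨U, hU⟩
  · have hGf := (mem_annih_map_iff hfi _ _ _ _).2 hG
    obtain ⟨U, _, hU⟩ := hfac (G.map f) (annih_mono _ n (by omega) hGf)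
    -- Padding with a power of `X` up to formal degree `n - h` sharpens the bound on the cofactor's
    -- degree to `m - h`.
    obtain ⟨U', hU'd, hU'⟩ := hfac (G.map f * X ^ (n - h - (m + 1))) (by
      have := mul_mem_annih hGf (natDegree_X_pow_le (n - h - (m + 1)))
      rwa [Nat.add_sub_cancel' (by omega)] at this)
    have hUU : U' = U * X ^ (n - h - (m + 1)) := by
      apply mul_left_cancel₀ hQf0
      rw [← hU', hU, mul_assoc]
    have hUd : U.natDegree ≤ m - h := by
      rcases eq_or_ne U 0 with rfl | hU0
      · simp
      · rw [hUU, natDegree_mul_X_pow _ hU0] at hU'd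
        omega
    rw [← mem_annih_map_iff hfi, hU]
    have := mul_mem_annih ((mem_annih_map_iff hfi _ _ _ _).2 hz) hUd
    rwa [show h + 1 + (m - h) = m + 1 by omega] at this

section

variable {ξ : ℝ} {n : ℕ} {lam C : ℝ} {q : ℕ → ℕ}

theorem IsRecordSeq.tendsto (h : IsRecordSeq ξ n lam C q) : Tendsto q atTop atTop :=
  h.strictMono.tendsto_atTop

theorem IsRecordSeq.approxErr_pos (h : IsRecordSeq ξ n lam C q) (i : ℕ) :
    0 < approxErr ξ n (q i) :=
  (approxErr_nonneg _).trans_lt (h.anti (Nat.lt_succ_self i))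

/-- By Dirichlet's theorem, each approximation has small recurrences. -/
theorem exists_small_recurrence (h : IsRecordSeq ξ n lam C q) (hC : 0 < C) {b : ℕ} (hb : 1 ≤ b)
    (hlam : 1 < lam * b) {ε : ℝ} (hε : 0 < ε) :
    ∃ i₀, ∀ i, i₀ ≤ i → ∃ G : ℤ[X], G ≠ 0 ∧ G ∈ annih (approxSeq ξ (q (i + 1))) n b ∧
      height G * approxErr ξ n (q i) < ε := by
  obtain ⟨c, hc, hdir⟩ := exists_small_value ξ hb
  have hΞ := one_le_powBound ξ n
  have hb0 : (0 : ℝ) < b := by exact_mod_cast hb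
  set B : ℝ := 4 * powBound ξ n * c + 1 with hB
  have hB1 : 1 ≤ B := by
    have : 0 ≤ 4 * powBound ξ n * c := by positivity
    linarith
  set M : ℝ := (B ^ (1 / (b : ℝ)) + 1) * C with hM
  have hM0 : 0 < M := by positivity
  have hqt : Tendsto (fun i => ((q (i + 1) : ℕ) : ℝ)) atTop atTop :=
    tendsto_natCast_atTop_atTop.comp (h.tendsto.comp (tendsto_add_atTop_nat 1))
  have hlt : 0 < lam - 1 / b := by
    rw [sub_pos, div_lt_iff₀ hb0]; exact hlam
  have ht : Tendsto (fun i => ((q (i + 1) : ℕ) : ℝ) ^ (-(lam - 1 / b))) atTop (nhds 0) :=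
    (tendsto_rpow_neg_atTop hlt).comp hqt
  set η : ℝ := min (ε / M) (1 / (4 * (n + 1) * M)) with hη
  have hη0 : 0 < η := by positivity
  obtain ⟨i₀, hi₀⟩ := eventually_atTop.1 (ht.eventually (gt_mem_nhds hη0))
  refine ⟨i₀, fun i hi => ?_⟩
  have hq1 : (1 : ℝ) ≤ q (i + 1) := by exact_mod_cast h.one_le (i + 1)
  set r : ℝ := (q (i + 1) : ℝ) with hr
  have hr0 : 0 < r := by linarith
  -- With `R` of order `r^(1/b)`, Dirichlet's value times `r` stays below a small constant, while
  -- `R` times the previous error is at most of order `r^(1/b - lam)`, which tends to `0`.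
  set R : ℕ := ⌈(B * r) ^ (1 / (b : ℝ))⌉₊ with hR
  have hBr : 1 ≤ (B * r) ^ (1 / (b : ℝ)) :=
    Real.one_le_rpow (one_le_mul_of_one_le_of_one_le hB1 hq1) (by positivity)
  have hR1 : 1 ≤ R := by
    rw [hR, Nat.one_le_ceil_iff]; linarith
  have hRle : (R : ℝ) ≤ (B ^ (1 / (b : ℝ)) + 1) * r ^ (1 / (b : ℝ)) := by
    have h1 := (Nat.ceil_lt_add_one (by linarith : 0 ≤ (B * r) ^ (1 / (b : ℝ)))).le
    rw [← hR, Real.mul_rpow (by linarith) hr0.le] at h1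
    have h2 : 1 ≤ r ^ (1 / (b : ℝ)) := Real.one_le_rpow hq1 (by positivity)
    linarith
  have hRb : B * r ≤ (R : ℝ) ^ b := by
    calc B * r = ((B * r) ^ (1 / (b : ℝ))) ^ b := by
          rw [← Real.rpow_natCast, ← Real.rpow_mul (by positivity), one_div_mul_cancel hb0.ne',
            Real.rpow_one]
      _ ≤ _ := by gcongr; exact Nat.le_ceil _
  have hRL : R * approxErr ξ n (q i) ≤ M * r ^ (-(lam - 1 / b)) := by
    calc _ ≤ ((B ^ (1 / (b : ℝ)) + 1) * r ^ (1 / (b : ℝ))) * (C * r ^ (-lam)) := by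
          have := h.bound i
          have := h.approxErr_pos i
          gcongr
      _ = M * (r ^ (1 / (b : ℝ)) * r ^ (-lam)) := by rw [hM]; ring
      _ = _ := by rw [← Real.rpow_add hr0]; congr 2; ring
  have hsmall := hi₀ i hi
  have hRL1 : R * approxErr ξ n (q i) < ε := by
    refine hRL.trans_lt ?_
    have := hsmall.trans_le (min_le_left _ _)
    rwa [lt_div_iff₀' hM0] at this
  have hRL2 : (n + 1) * R * approxErr ξ n (q (i + 1)) < 1 / 4 := by
    have h1 := hsmall.trans_le (min_le_right _ _)
    rw [lt_div_iff₀' (by positivity)] at h1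
    have h2 := (h.anti (Nat.lt_succ_self i)).le
    calc (n + 1) * R * approxErr ξ n (q (i + 1)) ≤ (n + 1) * R * approxErr ξ n (q i) := by gcongr
      _ = (n + 1) * (R * approxErr ξ n (q i)) := by ring
      _ ≤ (n + 1) * (M * r ^ (-(lam - 1 / b))) := by gcongr
      _ < 1 / 4 := by
        change 4 * (n + 1) * M * r ^ (-(lam - 1 / b)) < 1 at h1
        linarith
  obtain ⟨G, hG0, hGd, hGR, hGξ⟩ := hdir R hR1
  refine ⟨G, hG0, ⟨hGd, fun s hs => intCast_eq_zero_of_abs_lt_one ?_⟩, ?_⟩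
  · have h1 := abs_intPairing_sub_le (ξ := ξ) (n := n) (q (i + 1)) hGd hs hGR
    have h2 : |(q (i + 1) : ℝ) * ξ ^ s * aeval ξ G| ≤ 1 / 4 := by
      rw [abs_mul, abs_mul, Nat.abs_cast, ← hr]
      calc r * |ξ ^ s| * |aeval ξ G| ≤ r * powBound ξ n * (c / (R : ℝ) ^ b) := by
            gcongr
            exact abs_pow_le_powBound ξ (by omega)
        _ ≤ r * powBound ξ n * (c / (B * r)) := by gcongr
        _ = powBound ξ n * c / B := by field_simp
        _ ≤ 1 / 4 := by
          rw [div_le_div_iff₀ (by linarith) (by norm_num), hB]; linarith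
    have h3 := abs_add_le (((pairing (approxSeq ξ (q (i + 1))) (G * X ^ s) : ℤ) : ℝ) -
      q (i + 1) * ξ ^ s * aeval ξ G) (q (i + 1) * ξ ^ s * aeval ξ G)
    rw [sub_add_cancel] at h3
    linarith
  · refine lt_of_le_of_lt ?_ hRL1
    have := h.approxErr_pos i
    have := height_le_of_abs_coeff_le (Nat.cast_nonneg R) hGR
    gcongr

theorem approxSeq_zero (q : ℕ) : approxSeq ξ q 0 = q := by
  rw [approxSeq, pow_zero, mul_one]
  exact round_natCast q

/-- A small recurrence from Dirichlet's theorem is a multiple of a primitive minimal one. The latter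
is therefore small enough to hold for the previous approximation, and it generates all recurrences
of formal degree `m + 1`. -/
theorem exists_annih_succ_le (h : IsRecordSeq ξ n lam C q) (hC : 0 < C) {m : ℕ}
    (hn : 2 * m + 2 ≤ n) (hlam : 1 < lam * (n - m : ℕ)) :
    ∃ i₀, ∀ i, i₀ ≤ i →
      annih (approxSeq ξ (q (i + 1))) n (m + 1) ≤ annih (approxSeq ξ (q i)) n (m + 1) := by
  have hK := one_le_powBound ξ n
  set ε : ℝ := 1 / ((n + 1) * (powBound ξ n + 1) * (2 ^ n * (n + 1))) with hε
  obtain ⟨i₀, hi₀⟩ := exists_small_recurrence h hC (b := n - m) (by omega) hlam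
    (ε := ε) (by positivity)
  refine ⟨i₀, fun i hi => ?_⟩
  by_cases hbot : annih (approxSeq ξ (q (i + 1))) n (m + 1) = ⊥
  · rw [hbot]; exact bot_le
  obtain ⟨G, hG0, hG, hGs⟩ := hi₀ i hi
  obtain ⟨Q, hQ0, d, hd, hQ, hdvd, hall⟩ := exists_primitive_recurrence hn (by
    rw [approxSeq_zero]
    have := h.one_le (i + 1)
    omega) hbot
  apply hall
  obtain ⟨W, rfl⟩ := hdvd G hG
  have hW : W ≠ 0 := right_ne_zero_of_mul hG0
  have hht := height_le_of_mul hW (hG.1.trans (Nat.sub_le n m)) hQ0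
  refine mem_annih_of_mem_annih hQ (h.strictMono (Nat.lt_succ_self i)).le
    (h.anti (Nat.lt_succ_self i)).le ?_
  have hL := h.approxErr_pos i
  rw [hε, lt_div_iff₀ (by positivity)] at hGs
  calc (n + 1) * (powBound ξ n + 1) * height Q * approxErr ξ n (q i)
      ≤ (n + 1) * (powBound ξ n + 1) * (2 ^ n * (n + 1) * height (Q * W)) *
        approxErr ξ n (q i) := by gcongr
    _ < 1 := by linarith

/-- `q_i |F(ξ)|` stays bounded while `q_i` tends to infinity. -/
theorem aeval_eq_zero_of_forall_mem_annih (h : IsRecordSeq ξ n lam C q) {a i₀ : ℕ} (ha : a ≤ n)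
    {F : ℤ[X]} (hF : ∀ i, i₀ ≤ i → F ∈ annih (approxSeq ξ (q i)) n a) : aeval ξ F = 0 := by
  by_contra hne
  have hpos : 0 < |aeval ξ F| := abs_pos.2 hne
  have hqt : Tendsto (fun i => ((q i : ℕ) : ℝ)) atTop atTop :=
    tendsto_natCast_atTop_atTop.comp h.tendsto
  obtain ⟨i, h1, h2⟩ := ((hqt.eventually_gt_atTop ((n + 1) * height F / |aeval ξ F|)).and
    (eventually_ge_atTop i₀)).exists
  rw [div_lt_iff₀ hpos] at h1
  have h3 := mul_abs_aeval_le_of_mem_annih (hF i h2) ha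
  have h4 : (n + 1) * (height F : ℝ) * approxErr ξ n (q i) ≤ (n + 1) * height F :=
    mul_le_of_le_one_right (by positivity) (approxErr_le_one _)
  linarith

/-- The approximations have no recurrences of small degree. -/
theorem exists_annih_eq_bot (hξ : Transcendental ℚ ξ) (h : IsRecordSeq ξ n lam C q) (hC : 0 < C)
    {m : ℕ} (hn : 2 * m + 2 ≤ n) (hlam : 1 < lam * (n - m : ℕ)) :
    ∃ i₀, ∀ i, i₀ ≤ i → annih (approxSeq ξ (q i)) n (m + 1) = ⊥ := by
  obtain ⟨i₀, hi₀⟩ := exists_annih_succ_le h hC hn hlam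
  -- Coefficient vectors over `ℚ` give a descending chain in a finite-dimensional space; an element
  -- of its stable value is a recurrence of all later approximations.
  set V : ℕ → Submodule ℚ (Fin (m + 1 + 1) → ℚ) := fun i =>
    (annih (fun j => (approxSeq ξ (q (i₀ + i)) j : ℚ)) n (m + 1)).comap (vecPoly ℚ (m + 1 + 1))
    with hV
  have hanti : Antitone V := by
    apply antitone_nat_of_succ_le
    intro i
    exact Submodule.comap_mono (annih_rat_le (hi₀ (i₀ + i) (by omega)))
  obtain ⟨N, hN⟩ := IsArtinian.monotone_stabilizes
    (⟨fun i => OrderDual.toDual (V i), fun i j hij => hanti hij⟩ :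
      ℕ →o (Submodule ℚ (Fin (m + 1 + 1) → ℚ))ᵒᵈ)
  have hN' : ∀ i, N ≤ i → V N = V i := fun i hi => hN i hi
  refine ⟨i₀ + N, fun i hi => ?_⟩
  rw [Submodule.eq_bot_iff]
  intro F hF
  by_contra hF0
  have hmem : ∀ i', i₀ + N ≤ i' → F ∈ annih (approxSeq ξ (q i')) n (m + 1) := by
    intro i' hi'
    obtain ⟨u, hu⟩ := exists_vecPoly_eq (R := ℚ) (a := m + 1) (F := F.map (Int.castRingHom ℚ))
      (natDegree_map_le.trans hF.1)
    have h1 : u ∈ V (i - i₀) := by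
      rw [hV, Submodule.mem_comap, hu, Nat.add_sub_cancel' (by omega)]
      exact (mem_annih_map_iff (f := Int.castRingHom ℚ) Int.cast_injective _ _ _ _).2 hF
    rw [← hN' _ (by omega), hN' (i' - i₀) (by omega), hV, Submodule.mem_comap, hu,
      Nat.add_sub_cancel' (by omega)] at h1
    exact (mem_annih_map_iff (f := Int.castRingHom ℚ) Int.cast_injective _ _ _ _).1 h1
  exact aeval_ne_zero_of_transcendental hξ hF0
    (aeval_eq_zero_of_forall_mem_annih h (by omega) hmem)

end

/-! ### Recurrences that die at the next approximation. -/

section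

variable {ξ : ℝ} {n : ℕ} {lam C : ℝ} {q : ℕ → ℕ}

/-- The minimal recurrences of the approximations change infinitely often. -/
theorem exists_dying_recurrence (hξ : Transcendental ℚ ξ) (h : IsRecordSeq ξ n lam C q) (hC : 0 < C)
    {b : ℕ} (hb : 1 ≤ b) (hbn : b ≤ n) (hlam : 1 < lam * b) (i₀ : ℕ) :
    ∃ i, i₀ ≤ i ∧ ∃ G ∈ annih (approxSeq ξ (q i)) n b, G ≠ 0 ∧
      (∀ F ∈ annih (approxSeq ξ (q i)) n b, F ≠ 0 → height G ≤ height F) ∧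
      G ∉ annih (approxSeq ξ (q (i + 1))) n b := by
  classical
  by_contra! hcon
  -- If least-height recurrences always survived, one whose height is least over all indices from
  -- `i₀` on would remain minimal, hence survive forever and vanish at `ξ`.
  have hex : ∃ H, ∃ i, i₀ ≤ i ∧ ∃ G ∈ annih (approxSeq ξ (q i)) n b, G ≠ 0 ∧ height G = H := by
    obtain ⟨i₁, hi₁⟩ := exists_small_recurrence h hC hb hlam one_pos
    obtain ⟨G, h1, h2, _⟩ := hi₁ (max i₀ i₁) (le_max_right _ _)
    exact ⟨_, _, (le_max_left _ _).trans (Nat.le_succ _), G, h2, h1, rfl⟩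
  obtain ⟨i, hi, G, hG, hG0, hGH⟩ := Nat.find_spec hex
  have hmin : ∀ i', i₀ ≤ i' → ∀ F ∈ annih (approxSeq ξ (q i')) n b, F ≠ 0 → height G ≤ height F := by
    intro i' hi' F hF hF0
    rw [hGH]
    exact Nat.find_min' hex ⟨i', hi', F, hF, hF0, rfl⟩
  have hmem : ∀ i', i ≤ i' → G ∈ annih (approxSeq ξ (q i')) n b := by
    intro i' hi'
    induction i', hi' using Nat.le_induction with
    | base => exact hG
    | succ j hj ih => exact hcon j (by omega) G ih hG0 (hmin j (by omega))
  exact aeval_ne_zero_of_transcendental hξ hG0 (aeval_eq_zero_of_forall_mem_annih h hbn hmem)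

/-- A recurrence that dies at the next approximation is not too small. -/
theorem exists_one_le_height_mul {k m b : ℕ} {w : ℝ} (hw : k ≤ w) (hkm : k ≤ m) (hmn : m + b = n)
    (h : ∃ Q₀ : ℝ, ∀ Q, Q₀ ≤ Q → ∀ P : ℤ[X], P.natDegree ≤ k → (∀ j, |(P.coeff j : ℝ)| ≤ Q) →
      P ≠ 0 → Q ^ (-w) < |aeval ξ P|) :
    ∃ C T₀ : ℝ, 1 ≤ C ∧ 1 ≤ T₀ ∧ ∀ q q' : ℕ, 1 ≤ q → ∀ G ∈ annih (approxSeq ξ q) n b,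
      G ∉ annih (approxSeq ξ q') n b → ∀ T, T₀ ≤ T →
      1 ≤ C * height G * (q' / q * approxErr ξ n q * T ^ (-(k : ℝ)) +
        T ^ (1 + w - k) * approxErr ξ n q') := by
  obtain ⟨C, T₀, hC, hT₀, hex⟩ := exists_small_value_pairing_ne_zero hw h
  have hΞ := one_le_powBound ξ n
  have hn1 : (1 : ℝ) ≤ n + 1 := by linarith [(Nat.cast_nonneg n : (0 : ℝ) ≤ n)]
  refine ⟨(n + 1) ^ 2 * powBound ξ n * C, T₀, ?_, hT₀, ?_⟩
  · exact one_le_mul_of_one_le_of_one_le (one_le_mul_of_one_le_of_one_le (one_le_pow₀ hn1) hΞ) hC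
  intro q q' hq G hG hG' T hT
  have hq0 : (0 : ℝ) < q := by exact_mod_cast hq
  have hT0 : 0 < T := by linarith
  obtain ⟨j, hj, hjne⟩ : ∃ j, b + j ≤ n ∧ pairing (approxSeq ξ q') (G * X ^ j) ≠ 0 := by
    by_contra! hc
    exact hG' ⟨hG.1, hc⟩
  -- The truncated `j - k` starts a window of `k + 1` consecutive shifts containing `j`. It stays
  -- within the available shifts because `k ≤ m`.
  obtain ⟨P, hPd, hPc, hPv, hP⟩ := hex T hT
    (fun l => pairing (approxSeq ξ q') (G * X ^ (l + (j - k)))) ⟨j - (j - k), by omega, by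
      rwa [Nat.sub_add_cancel (Nat.sub_le _ _)]⟩
  set t := j - k with ht
  set z : ℕ → ℤ := fun l => pairing (approxSeq ξ q') (G * X ^ (l + t)) with hz
  have hL' := approxErr_nonneg (ξ := ξ) (n := n) q'
  have hL := approxErr_nonneg (ξ := ξ) (n := n) q
  have hP1 : 1 ≤ |((pairing z P : ℤ) : ℝ)| := by
    rw [← Int.cast_abs]
    exact_mod_cast Int.one_le_abs hP
  have hsum : ((pairing z P : ℤ) : ℝ) = ∑ l ∈ Finset.range (k + 1), (P.coeff l : ℝ) * z l := by
    have := pairing_mul_X_pow_eq_sum z hPd 0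
    rw [pow_zero, mul_one] at this
    rw [this]
    push_cast
    rfl
  have heval : aeval ξ P = ∑ l ∈ Finset.range (k + 1), (P.coeff l : ℝ) * ξ ^ l := by
    rw [aeval_eq_sum_range' (by omega : P.natDegree < k + 1)]
    simp
  -- Each `z l` is close to `q' ξ^(l+t) G(ξ)`, so the nonzero integer `pairing z P` is close to `q'
  -- ξ^t G(ξ) P(ξ)`.
  have hdiff : |((pairing z P : ℤ) : ℝ) - q' * ξ ^ t * aeval ξ G * aeval ξ P| ≤
      (n + 1) * (C * T ^ (1 + w - k) * ((n + 1) * height G * approxErr ξ n q')) := by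
    rw [hsum, heval, Finset.mul_sum, ← Finset.sum_sub_distrib]
    calc _ ≤ ∑ l ∈ Finset.range (k + 1),
          |(P.coeff l : ℝ) * z l - q' * ξ ^ t * aeval ξ G * (P.coeff l * ξ ^ l)| :=
          Finset.abs_sum_le_sum_abs _ _
      _ ≤ ∑ _l ∈ Finset.range (k + 1),
          C * T ^ (1 + w - k) * ((n + 1) * height G * approxErr ξ n q') := by
          refine Finset.sum_le_sum fun l hl => ?_
          have hlk := Finset.mem_range.1 hl
          have h1 : (P.coeff l : ℝ) * z l - q' * ξ ^ t * aeval ξ G * (P.coeff l * ξ ^ l) =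
              P.coeff l * (z l - q' * ξ ^ (l + t) * aeval ξ G) := by rw [pow_add]; ring
          rw [h1, abs_mul]
          exact mul_le_mul (hPc l) (abs_intPairing_sub_le q' hG.1 (by omega)
            (abs_coeff_le_height G)) (abs_nonneg _) (by positivity)
      _ = (k + 1) * (C * T ^ (1 + w - k) * ((n + 1) * height G * approxErr ξ n q')) := by simp
      _ ≤ _ := by
          gcongr
          exact_mod_cast (by omega : k ≤ n)
  have hmain : |(q' : ℝ) * ξ ^ t * aeval ξ G * aeval ξ P| ≤
      q' * powBound ξ n * ((n + 1) * height G * approxErr ξ n q / q) * (C * T ^ (-(k : ℝ))) := by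
    rw [abs_mul, abs_mul, abs_mul, Nat.abs_cast]
    have h1 : |aeval ξ G| ≤ (n + 1) * height G * approxErr ξ n q / q := by
      rw [le_div_iff₀' hq0]
      exact mul_abs_aeval_le_of_mem_annih hG (by omega)
    have h2 := abs_pow_le_powBound ξ (n := n) (j := t) (by omega)
    gcongr
  have h3 := abs_add_le (((pairing z P : ℤ) : ℝ) - q' * ξ ^ t * aeval ξ G * aeval ξ P)
    (q' * ξ ^ t * aeval ξ G * aeval ξ P)
  rw [sub_add_cancel] at h3
  have h4 : (n + 1) * (C * T ^ (1 + w - k) * ((n + 1) * height G * approxErr ξ n q')) ≤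
      (n + 1) ^ 2 * powBound ξ n * C * height G * (T ^ (1 + w - k) * approxErr ξ n q') := by
    have h5 : 0 ≤ (n + 1) ^ 2 * C * height G * (T ^ (1 + w - k) * approxErr ξ n q') := by
      positivity
    nlinarith [mul_le_mul_of_nonneg_right hΞ h5]
  have h5 : q' * powBound ξ n * ((n + 1) * height G * approxErr ξ n q / q) * (C * T ^ (-(k : ℝ))) ≤
      (n + 1) ^ 2 * powBound ξ n * C * height G *
        (q' / q * approxErr ξ n q * T ^ (-(k : ℝ))) := by
    have h6 : 0 ≤ (n + 1) * powBound ξ n * C * height G *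
        (q' / q * approxErr ξ n q * T ^ (-(k : ℝ))) := by positivity
    calc _ = 1 * ((n + 1) * powBound ξ n * C * height G *
        (q' / q * approxErr ξ n q * T ^ (-(k : ℝ)))) := by field_simp
      _ ≤ (n + 1) * ((n + 1) * powBound ξ n * C * height G *
        (q' / q * approxErr ξ n q * T ^ (-(k : ℝ)))) := by gcongr
      _ = _ := by ring
  rw [mul_add]
  linarith

/-- Successive approximations are not proportional, so the recurrences of the later one do not all
hold for the earlier one. -/
theorem exists_recurrence_pairing_ne_zero {m b i : ℕ} (h : IsRecordSeq ξ n lam C q) (hmn : m + b = n)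
    (hbot : annih (approxSeq ξ (q (i + 1))) n (m + 1) = ⊥) :
    ∃ G ∈ annih (approxSeq ξ (q (i + 1))) n b, ∃ s ≤ m,
      pairing (approxSeq ξ (q i)) (G * X ^ s) ≠ 0 := by
  by_contra! hcon
  obtain ⟨t, ht⟩ := eq_smul_of_annih_le hmn (annih_rat_eq_bot hbot) (annih_rat_le
    (z := approxSeq ξ (q i)) fun G hG => ⟨hG.1, fun s hs => hcon G hG s (by omega)⟩)
  have hqi : (1 : ℝ) ≤ q (i + 1) := by exact_mod_cast h.one_le (i + 1)
  have ht' : ∀ j ≤ n, (approxSeq ξ (q i) j : ℝ) = t * approxSeq ξ (q (i + 1)) j := by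
    intro j hj
    have := ht j hj
    exact_mod_cast congrArg (fun x : ℚ => (x : ℝ)) this
  -- The entries of index `0` are the denominators, so `0 ≤ t ≤ 1`, and proportionality would make
  -- the earlier error no larger than the later one.
  have ht0 := ht' 0 (Nat.zero_le n)
  rw [approxSeq_zero, approxSeq_zero] at ht0
  push_cast at ht0
  have hlt : (q i : ℝ) ≤ q (i + 1) := by exact_mod_cast (h.strictMono (Nat.lt_succ_self i)).le
  have ht1 : 0 ≤ (t : ℝ) := by
    by_contra hneg
    have : (0 : ℝ) ≤ q i := Nat.cast_nonneg _
    nlinarith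
  have ht2 : (t : ℝ) ≤ 1 := by
    by_contra hgt
    nlinarith
  refine absurd (h.anti (Nat.lt_succ_self i)) (not_lt.2 ?_)
  apply Finset.sup'_le
  intro j hj
  have hj' : j ≤ n := Nat.lt_succ_iff.1 (Finset.mem_range.1 hj)
  rw [ht' j hj', ht0, mul_assoc, ← mul_sub, abs_mul, abs_of_nonneg ht1]
  calc _ ≤ 1 * approxErr ξ n (q (i + 1)) := by
        gcongr
        exact abs_sub_approxSeq_le _ hj'
    _ = _ := one_mul _

end

/-! ### Combination of the estimates. -/

/-- The linear inequalities between the logarithms of successive denominators bound them. -/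
theorem exists_log_bound {lam g c c' m D : ℝ} (hN : 1 < lam * (m + 1 + D))
    (hg : g ≤ 1 - lam ∨ (1 - (m + 1) * lam) * g < lam * (D - (1 - (m + 1) * lam))) :
    ∃ B, ∀ x y : ℝ, x ≤ y → 0 ≤ c + (1 - lam - g) * x + (g - lam * (m + D)) * y →
      0 ≤ c' + x - (m + 1) * lam * y → y ≤ B := by
  rcases le_or_gt g (1 - lam) with h1 | h1
  · refine ⟨c / (lam * (m + 1 + D) - 1), fun x y hxy h2 _ => ?_⟩
    rw [le_div_iff₀ (by linarith)]
    have := mul_le_mul_of_nonneg_left hxy (by linarith : 0 ≤ 1 - lam - g)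
    linarith
  -- Here the coefficient of `x` is negative; adding `g - 1 + lam` times the second inequality
  -- eliminates `x`.
  · have h2 := hg.resolve_left (not_le.2 h1)
    refine ⟨(c + (g - 1 + lam) * c') /
      (lam * (D - (1 - (m + 1) * lam)) - (1 - (m + 1) * lam) * g), fun x y _ h3 h4 => ?_⟩
    rw [le_div_iff₀ (by linarith)]
    have := mul_nonneg (by linarith : 0 ≤ g - 1 + lam) h4
    linarith

/-- The exponents for which the uniform approximation problem has no solution. -/
theorem false_of_uniform_approximation {ξ : ℝ} (hξ : Transcendental ℚ ξ) {k m D n : ℕ} {w lam : ℝ}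
    (hk : 1 ≤ k) (hkm : k ≤ m) (hD : 1 ≤ D) (hn : m + (m + 1 + D) = n) (hw : k ≤ w)
    (hsmall : ∃ Q₀ : ℝ, ∀ Q, Q₀ ≤ Q → ∀ P : ℤ[X], P.natDegree ≤ k →
      (∀ j, |(P.coeff j : ℝ)| ≤ Q) → P ≠ 0 → Q ^ (-w) < |aeval ξ P|)
    (hN : 1 < lam * (m + 1 + D))
    (hg : D * ((1 + w - k) / (1 + w)) ≤ 1 - lam ∨ (1 - (m + 1) * lam) *
      (D * ((1 + w - k) / (1 + w))) < lam * (D - (1 - (m + 1) * lam)))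
    (h : ∀ᶠ Q : ℝ in atTop, ∃ x : Fin (n + 1) → ℤ,
      1 ≤ |(x 0 : ℝ)| ∧ |(x 0 : ℝ)| ≤ Q ∧
      ∀ i : Fin n, |(x 0 : ℝ) * ξ ^ ((i : ℕ) + 1) - (x i.succ : ℝ)| < Q ^ (-lam)) : False := by
  have hlam : 0 < lam := by
    by_contra hneg
    have : (0 : ℝ) ≤ m + 1 + D := by positivity
    nlinarith
  obtain ⟨C, q, hC, hrec⟩ := exists_isRecordSeq hξ.irrational (by omega : 1 ≤ n) hlam h
  have hb : ((m + 1 + D : ℕ) : ℝ) = m + 1 + D := by push_cast; ring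
  have hN' : 1 < lam * (m + 1 + D : ℕ) := by rwa [hb]
  obtain ⟨i₁, hi₁⟩ := exists_annih_eq_bot hξ hrec hC (m := m) (by omega)
    (by rwa [show n - m = m + 1 + D by omega])
  obtain ⟨C₁, T₀, hC₁, hT₀, hdie⟩ := exists_one_le_height_mul hw hkm hn hsmall
  have hK := one_le_shiftBound ξ n
  have hk0 : (0 : ℝ) < k := by exact_mod_cast hk
  set s : ℝ := 1 + w - k with hs
  set g : ℝ := (1 + w - k) / (1 + w) with hgdef
  set c₁ : ℝ := Real.log (C₁ * (1 + T₀ ^ s)) with hc₁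
  set c₂ : ℝ := Real.log ((4 * shiftBound ξ n) ^ (m + 2) * 3 ^ D) with hc₂
  set c₃ : ℝ := Real.log (4 * shiftBound ξ n * (2 * shiftBound ξ n) ^ (m + 1)) with hc₃
  obtain ⟨B, hB⟩ := exists_log_bound (c := D * c₁ + c₂ + (m + D + 1) * Real.log C)
    (c' := c₃ + (m + 1) * Real.log C) hN hg
  have hlogt : Tendsto (fun i => Real.log (q (i + 1))) atTop atTop :=
    Real.tendsto_log_atTop.comp (tendsto_natCast_atTop_atTop.comp
      (hrec.tendsto.comp (tendsto_add_atTop_nat 1)))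
  obtain ⟨i₂, hi₂⟩ := eventually_atTop.1 (hlogt.eventually_gt_atTop B)
  obtain ⟨i', hi', G, hG, hG0, hGmin, hGdie⟩ := exists_dying_recurrence hξ hrec hC
    (by omega : 1 ≤ m + 1 + D) (by omega) hN' (max (i₁ + 1) i₂)
  obtain ⟨i, rfl⟩ : ∃ i, i' = i + 1 :=
    ⟨i' - 1, by have := (le_max_left _ _).trans hi'; omega⟩
  have hbot := hi₁ (i + 1) (((Nat.le_succ _).trans (le_max_left _ _)).trans hi')
  obtain ⟨G₀, hG₀, s₀, hs₀, hG₀s⟩ := exists_recurrence_pairing_ne_zero hrec hn hbot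
  have hH1 : 1 ≤ height G := one_le_height hG0
  have hbotm : annih (approxSeq ξ (q (i + 1))) n m = ⊥ := by
    rw [eq_bot_iff, ← hbot]; exact annih_mono _ _ (Nat.le_succ m)
  have hkey := height_pow_le hn (hrec.one_le (i + 1)) (hrec.strictMono (Nat.lt_succ_self i)).le
    (hrec.anti (Nat.lt_succ_self i)).le (hrec.approxErr_pos (i + 1)) hs₀
    (annih_rat_eq_bot hbotm) hG₀ hG₀s hH1 hGmin
  have hM := one_le_mul_pow_of_annih_eq_bot (hrec.one_le (i + 1)) (by omega : m + 1 ≤ n)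
    (hrec.approxErr_pos (i + 1)) hbot
  have hb1 := hrec.bound i
  have hb2 := hrec.bound (i + 1)
  have hL0 := hrec.approxErr_pos i
  have hL1 := hrec.approxErr_pos (i + 1)
  have hL21 := (hrec.anti (Nat.lt_succ_self (i + 1))).le
  have hq1 : (1 : ℝ) ≤ q (i + 1) := by exact_mod_cast hrec.one_le (i + 1)
  have hq12 : (q (i + 1) : ℝ) ≤ q (i + 1 + 1) := by
    exact_mod_cast (hrec.strictMono (Nat.lt_succ_self (i + 1))).le
  have hdieT := hdie _ (q (i + 1 + 1)) (hrec.one_le (i + 1)) G hG hGdie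
  have hlarge := hi₂ (i + 1) ((le_max_right _ _).trans hi')
  set x : ℝ := (q (i + 1) : ℝ) with hx
  set y : ℝ := (q (i + 1 + 1) : ℝ) with hy
  set L := approxErr ξ n (q (i + 1)) with hL
  set L' := approxErr ξ n (q i) with hL'
  have hx0 : 0 < x := by linarith
  have hy0 : 0 < y := by linarith
  have hyx : 1 ≤ y / x := (one_le_div hx0).2 hq12
  have hH0 : (0 : ℝ) < height G := by exact_mod_cast hH1
  have hw0 : 0 < 1 + w := by linarith
  have hs0 : 0 < s := by rw [hs]; linarith
  have hdie' : 1 ≤ C₁ * (1 + T₀ ^ s) * (height G * ((y / x) ^ g * L)) := by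
    -- Up to the factor `T₀`, this choice balances `(y/x) T^(-k)` with `T^(1+w-k)`; both become
    -- `(y/x)^g`.
    set T : ℝ := T₀ * (y / x) ^ (1 / (1 + w)) with hT
    have hyx1 : 1 ≤ (y / x) ^ (1 / (1 + w)) := Real.one_le_rpow hyx (by positivity)
    have h1 := hdieT T (le_mul_of_one_le_right (by linarith) hyx1)
    have h2 : T ^ (-(k : ℝ)) ≤ (y / x) ^ (g - 1) := by
      rw [hT, Real.mul_rpow (by linarith) (by positivity), ← Real.rpow_mul (by positivity)]
      have h3 : 1 / (1 + w) * -(k : ℝ) = g - 1 := by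
        rw [hgdef]; field_simp; ring
      rw [h3]
      exact mul_le_of_le_one_left (by positivity)
        (Real.rpow_le_one_of_one_le_of_nonpos hT₀ (by linarith))
    have h4 : T ^ s = T₀ ^ s * (y / x) ^ g := by
      rw [hT, Real.mul_rpow (by linarith) (by positivity), ← Real.rpow_mul (by positivity)]
      congr 2
      rw [hgdef, hs]; field_simp
    have h5 : y / x * (y / x) ^ (g - 1) = (y / x) ^ g := by
      rw [Real.rpow_sub (by positivity), Real.rpow_one]; field_simp
    calc (1 : ℝ) ≤ _ := h1
      _ ≤ C₁ * height G * (y / x * L * (y / x) ^ (g - 1) + T₀ ^ s * (y / x) ^ g * L) := by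
          rw [h4]; gcongr
      _ = C₁ * height G * (y / x * (y / x) ^ (g - 1) * L + T₀ ^ s * (y / x) ^ g * L) := by ring
      _ = _ := by rw [h5]; ring
  have e1 : 0 ≤ c₁ + (Real.log (height G) + (g * (Real.log y - Real.log x) + Real.log L)) := by
    have := Real.log_nonneg hdie'
    rwa [Real.log_mul (x := C₁ * (1 + T₀ ^ s)) (by positivity) (by positivity),
      Real.log_mul hH0.ne' (by positivity), Real.log_mul (x := (y / x) ^ g) (by positivity)
      (by positivity), Real.log_rpow (by positivity),
      Real.log_div (by positivity) (by positivity)] at this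
  have e2 : D * Real.log (height G) ≤ c₂ + (Real.log x + m * Real.log L + Real.log L') := by
    have := Real.log_le_log (by positivity) hkey
    rwa [Real.log_mul (y := x * L ^ m * L') (by positivity) (by positivity),
      Real.log_mul (y := L') (by positivity) (by positivity),
      Real.log_mul hx0.ne' (by positivity), Real.log_pow (height G : ℝ), Real.log_pow L] at this
  have e3 : 0 ≤ c₃ + (Real.log x + (m + 1) * Real.log L) := by
    have := Real.log_nonneg hM
    rw [Real.log_mul (y := x * L ^ (m + 1)) (by positivity) (by positivity),
      Real.log_mul hx0.ne' (by positivity), Real.log_pow L] at this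
    exact_mod_cast this
  have e4 : Real.log L' ≤ Real.log C - lam * Real.log x := by
    have := Real.log_le_log hL0 hb1
    rw [Real.log_mul (by positivity) (by positivity), Real.log_rpow hx0] at this
    linarith
  have e5 : Real.log L ≤ Real.log C - lam * Real.log y := by
    have := Real.log_le_log hL1 hb2
    rw [Real.log_mul (by positivity) (by positivity), Real.log_rpow hy0] at this
    linarith
  refine absurd (hB (Real.log x) (Real.log y) (Real.log_le_log hx0 hq12) ?_ ?_) (not_le.2 hlarge)
  · have f1 := mul_nonneg (Nat.cast_nonneg D : (0 : ℝ) ≤ D) e1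
    have f2 := mul_le_mul_of_nonneg_left e5 (by positivity : (0 : ℝ) ≤ m + D)
    linarith
  · have f2 := mul_le_mul_of_nonneg_left e5 (by positivity : (0 : ℝ) ≤ m + 1)
    linarith

/-! ### From inequalities to the exponents of the theorem. -/

/-- Admissible exponents are closed downwards, so it suffices to exclude a right neighbourhood of
`x`. -/
theorem uniformSimultaneousExponent_le {n : ℕ} {ξ x ε : ℝ} (hε : 0 < ε)
    (h : ∀ lam, x < lam → lam < x + ε → ¬ ∀ᶠ Q : ℝ in atTop, ∃ x : Fin (n + 1) → ℤ,
      1 ≤ |(x 0 : ℝ)| ∧ |(x 0 : ℝ)| ≤ Q ∧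
      ∀ i : Fin n, |(x 0 : ℝ) * ξ ^ ((i : ℕ) + 1) - (x i.succ : ℝ)| < Q ^ (-lam)) :
    uniformSimultaneousExponent n ξ ≤ (x : EReal) := by
  by_contra hcon
  rw [not_le, uniformSimultaneousExponent, lt_sSup_iff] at hcon
  obtain ⟨_, ⟨lam, hlam, rfl⟩, hlt⟩ := hcon
  have hlt' : x < lam := EReal.coe_lt_coe_iff.1 hlt
  obtain ⟨lam', h1, h2⟩ := exists_between (lt_min hlt' (by linarith : x < x + ε))
  refine h lam' h1 (h2.trans_le (min_le_right _ _)) ?_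
  filter_upwards [hlam, eventually_ge_atTop 1] with Q ⟨z, hz1, hz2, hz3⟩ hQ
  refine ⟨z, hz1, hz2, fun i => (hz3 i).trans_le ?_⟩
  exact Real.rpow_le_rpow_of_exponent_le hQ (by linarith [min_le_left lam (x + ε)])

theorem lt_abs_aeval_of_dualExponent_lt {ξ : ℝ} (hξ : Transcendental ℚ ξ) {k : ℕ} {w : ℝ}
    (h : dualExponent k ξ < w) : ∃ Q₀ : ℝ, ∀ Q, Q₀ ≤ Q → ∀ P : ℤ[X], P.natDegree ≤ k →
      (∀ j, |(P.coeff j : ℝ)| ≤ Q) → P ≠ 0 → Q ^ (-w) < |aeval ξ P| := by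
  have h1 : ¬ ∃ᶠ Q : ℝ in atTop, ∃ P : ℤ[X], P.natDegree ≤ k ∧ (∀ j : ℕ, |(P.coeff j : ℝ)| ≤ Q) ∧
      0 < |aeval ξ P| ∧ |aeval ξ P| ≤ Q ^ (-w) := fun hf =>
    absurd (le_sSup (Set.mem_image_of_mem _ hf)) (not_le.2 h)
  rw [not_frequently] at h1
  obtain ⟨Q₀, hQ₀⟩ := eventually_atTop.1 h1
  refine ⟨Q₀, fun Q hQ P hP1 hP2 hP0 => ?_⟩
  by_contra hle
  exact hQ₀ Q hQ ⟨P, hP1, hP2, abs_pos.2 (aeval_ne_zero_of_transcendental hξ hP0), not_lt.1 hle⟩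

theorem exists_dualExponent_eq {ξ : ℝ} (hξ : Transcendental ℚ ξ) {k : ℕ} (hk : 1 ≤ k)
    (hδ : 0 < deltaRatio k ξ) :
    ∃ w : ℝ, (k : ℝ) ≤ w ∧ dualExponent k ξ = w ∧ deltaRatio k ξ = k / (w + 1 - k) := by
  have hle := le_dualExponent hξ hk
  unfold deltaRatio at hδ ⊢
  have hkr : ((k : ℕ) : EReal) = ((k : ℝ) : EReal) := rfl
  induction hw : dualExponent k ξ with
  | bot =>
    rw [hw, le_bot_iff] at hle
    exact absurd hle (EReal.coe_ne_bot (k : ℝ))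
  | top =>
    rw [hw, hkr, ← EReal.coe_one, EReal.top_add_coe, EReal.top_sub_coe, EReal.div_top] at hδ
    simp at hδ
  | coe w =>
    rw [hw, hkr, EReal.coe_le_coe_iff] at hle
    refine ⟨w, hle, rfl, ?_⟩
    rw [hkr, ← EReal.coe_one, ← EReal.coe_add, ← EReal.coe_sub, ← EReal.coe_div, EReal.toReal_coe]

/-- The exponents excluded in terms of `δ_k`. -/
theorem not_uniform_approximation {ξ : ℝ} (hξ : Transcendental ℚ ξ) {k m D n : ℕ} {lam : ℝ}
    (hk : 1 ≤ k) (hδ : 0 < deltaRatio k ξ) (hkm : k ≤ m) (hD : 1 ≤ D) (hn : m + (m + 1 + D) = n)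
    (hN : 1 < lam * (m + 1 + D))
    (hg : D / (1 + deltaRatio k ξ) < 1 - lam ∨ (1 - (m + 1) * lam) * (D / (1 + deltaRatio k ξ)) <
      lam * (D - (1 - (m + 1) * lam))) :
    ¬ ∀ᶠ Q : ℝ in atTop, ∃ x : Fin (n + 1) → ℤ, 1 ≤ |(x 0 : ℝ)| ∧ |(x 0 : ℝ)| ≤ Q ∧
      ∀ i : Fin n, |(x 0 : ℝ) * ξ ^ ((i : ℕ) + 1) - (x i.succ : ℝ)| < Q ^ (-lam) := by
  intro h
  obtain ⟨w, hkw, hw, hd⟩ := exists_dualExponent_eq hξ hk hδ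
  have hw0 : 0 < 1 + w := by linarith [(Nat.cast_nonneg k : (0 : ℝ) ≤ k)]
  have hg0 : D / (1 + deltaRatio k ξ) = D * ((1 + w - k) / (1 + w)) := by
    have h1 : 0 < w + 1 - k := by linarith
    have h2 : 1 + deltaRatio k ξ = (1 + w) / (1 + w - k) := by
      rw [hd, add_comm w 1]
      rw [add_comm w 1] at h1
      field_simp
      ring
    rw [h2, div_div_eq_mul_div, mul_div_assoc]
  rw [hg0] at hg
  -- The lower bound on values needs an exponent strictly above `ω_k`; the strict inequalities in
  -- `hg` persist for `v` slightly larger.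
  have hcont : Tendsto (fun v : ℝ => D * ((1 + v - k) / (1 + v))) (nhdsWithin w (Set.Ioi w))
      (nhds (D * ((1 + w - k) / (1 + w)))) := by
    have : ContinuousAt (fun v : ℝ => D * ((1 + v - k) / (1 + v))) w := by
      fun_prop (disch := exact hw0.ne')
    exact this.tendsto.mono_left nhdsWithin_le_nhds
  obtain ⟨v, hv, hvw⟩ : ∃ v, (D * ((1 + v - k) / (1 + v)) ≤ 1 - lam ∨ (1 - (m + 1) * lam) *
      (D * ((1 + v - k) / (1 + v))) < lam * (D - (1 - (m + 1) * lam))) ∧ w < v := by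
    rcases hg with hg | hg
    · obtain ⟨v, h1, h2⟩ := ((hcont.eventually (gt_mem_nhds hg)).and self_mem_nhdsWithin).exists
      exact ⟨v, Or.inl h1.le, h2⟩
    · obtain ⟨v, h1, h2⟩ := (((hcont.const_mul (1 - (m + 1) * lam)).eventually
        (gt_mem_nhds hg)).and self_mem_nhdsWithin).exists
      exact ⟨v, Or.inr h1, h2⟩
  refine false_of_uniform_approximation hξ hk hkm hD hn (hkw.trans hvw.le)
    (lt_abs_aeval_of_dualExponent_lt hξ ?_) hN hv h
  rw [hw]
  exact_mod_cast hvw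

/-- Clearing denominators gives the threshold of the second alternative in `exists_log_bound`, with
`D / (1 + d)` for `g`. -/
theorem rootQuadratic_mul {m D : ℕ} (hD : 1 ≤ D) {d : ℝ} (hd : 0 < d) (x : ℝ) :
    rootQuadratic (m + (m + 1 + D)) m d x * (d * D) =
      D * (1 - (m + 1) * x) - x * (1 + d) * (D - (1 - (m + 1) * x)) := by
  have hD0 : (0 : ℝ) < D := by exact_mod_cast hD
  have h1 : ((m + (m + 1 + D) : ℕ) : ℝ) - 2 * m - 1 = D := by push_cast; ring
  have h2 : ((m + (m + 1 + D) : ℕ) : ℝ) - m - 1 = D + m := by push_cast; ring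
  have h3 : ((m + (m + 1 + D) : ℕ) : ℝ) - 2 * m - 2 + x = D - 1 + x := by push_cast; ring
  rw [rootQuadratic, h1, h2, h3]
  field_simp
  ring

theorem exists_unique_root {m D : ℕ} (hD : 1 ≤ D) {d : ℝ} (hd : 0 < d) :
    ∃ x : ℝ, 0 < x ∧ rootQuadratic (m + (m + 1 + D)) m d x = 0 ∧
      (∀ y : ℝ, 0 < y → rootQuadratic (m + (m + 1 + D)) m d y = 0 → y = x) ∧
      ∀ y : ℝ, x < y → D * (1 - (m + 1) * y) - y * (1 + d) * (D - (1 - (m + 1) * y)) < 0 := by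
  have hD0 : (0 : ℝ) < D := by exact_mod_cast hD
  have hm0 : (0 : ℝ) ≤ m := Nat.cast_nonneg m
  set f : ℝ → ℝ := fun x => D * (1 - (m + 1) * x) - x * (1 + d) * (D - (1 - (m + 1) * x)) with hf
  have hiff : ∀ x, rootQuadratic (m + (m + 1 + D)) m d x = 0 ↔ f x = 0 := by
    intro x
    rw [hf]
    simp only
    rw [← rootQuadratic_mul hD hd x, mul_eq_zero, or_iff_left (by positivity)]
  -- This identity says that `f x / x` is strictly decreasing for `x > 0`, giving both uniqueness
  -- and the sign beyond the root.
  have hkey : ∀ x y, y * f x - x * f y = (y - x) * ((m + 1) * (1 + d) * x * y + D) := by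
    intro x y
    rw [hf]
    ring
  have hcont : Continuous f := by rw [hf]; fun_prop
  have hmem : (0 : ℝ) ∈ Set.Ioo (f 1) (f 0) := by
    rw [hf]
    constructor
    · have h1 : 0 ≤ D * (m : ℝ) := by positivity
      have h2 : 0 < (1 + d) * (D + m) := by positivity
      linarith
    · simpa using hD0
  obtain ⟨x, ⟨hx0, _⟩, hx⟩ := intermediate_value_Ioo' zero_le_one hcont.continuousOn hmem
  refine ⟨x, hx0, (hiff x).2 hx, fun y hy0 hy => ?_, fun y hy => ?_⟩
  · rw [hiff] at hy
    have h1 := hkey x y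
    rw [hx, hy, mul_zero, mul_zero, sub_zero, eq_comm, mul_eq_zero] at h1
    have h2 : 0 < ((m : ℝ) + 1) * (1 + d) * x * y + D := by positivity
    linarith [h1.resolve_right h2.ne']
  · change f y < 0
    have h1 := hkey x y
    have hy0 : 0 < y := hx0.trans hy
    have h2 : 0 < (y - x) * (((m : ℝ) + 1) * (1 + d) * x * y + D) :=
      mul_pos (by linarith) (by positivity)
    rw [hx, mul_zero, zero_sub] at h1
    by_contra hneg
    have := mul_nonneg hx0.le (not_lt.1 hneg)
    linarith

end

theorem theorem4 (ξ : ℝ) (hξ : Transcendental ℚ ξ) (k : ℕ) (hk : 1 ≤ k) (n : ℕ) :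
    (∀ m : ℕ,
      IsLeast {m : ℕ | k ≤ m ∧ 2 * m + 2 ≤ n ∧
        (n : ℝ) < 2 * (m : ℝ) + 1 + (1 - 1 / ((n : ℝ) - m)) * (1 + deltaRatio k ξ)} m →
      uniformSimultaneousExponent n ξ ≤ ((1 / ((n : ℝ) - m) : ℝ) : EReal)) ∧
    (∀ m : ℕ, k ≤ m → 2 * m + 2 ≤ n → 0 < deltaRatio k ξ →
      ∃ x : ℝ,
        (0 < x ∧ rootQuadratic n m (deltaRatio k ξ) x = 0 ∧
          ∀ y : ℝ, 0 < y → rootQuadratic n m (deltaRatio k ξ) y = 0 → y = x) ∧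
        (2 * (m : ℝ) + 1 + (1 - x) * (1 + deltaRatio k ξ) ≤ (n : ℝ) →
          uniformSimultaneousExponent n ξ ≤ (x : EReal))) := by
  refine ⟨fun m hm => ?_, fun m hkm hmn hδ => ?_⟩
  · obtain ⟨hkm, hmn, hlt⟩ := hm.1
    obtain ⟨D, hn⟩ : ∃ D, n = m + (m + 1 + D) := ⟨n - (2 * m + 1), by omega⟩
    have hD : 1 ≤ D := by omega
    have hD1 : (1 : ℝ) ≤ D := by exact_mod_cast hD
    have hm0 : (0 : ℝ) ≤ m := Nat.cast_nonneg m
    have hnm : (n : ℝ) - m = m + 1 + D := by rw [hn]; push_cast; ring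
    have hn' : (n : ℝ) = 2 * m + 1 + D := by rw [hn]; push_cast; ring
    rw [hnm] at hlt ⊢
    set N : ℝ := m + 1 + D with hN
    have hN0 : 0 < N := by positivity
    have hN1 : 0 < 1 / N := by positivity
    have hN2 : 1 / N ≤ 1 := by rw [div_le_one hN0]; linarith
    have hlt' : D < (1 - 1 / N) * (1 + deltaRatio k ξ) := by linarith
    have hδ : 0 < deltaRatio k ξ := by
      by_contra hneg
      have := mul_le_mul_of_nonneg_left (by linarith : 1 + deltaRatio k ξ ≤ 1)
        (by linarith : 0 ≤ 1 - 1 / N)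
      linarith
    have hgap : D / (1 + deltaRatio k ξ) < 1 - 1 / N := by
      rw [div_lt_iff₀ (by linarith)]; exact hlt'
    refine uniformSimultaneousExponent_le
      (ε := 1 - 1 / N - D / (1 + deltaRatio k ξ)) (by linarith) fun lam h1 h2 => ?_
    refine not_uniform_approximation hξ hk hδ hkm hD hn.symm ?_ (Or.inl (by linarith))
    rwa [div_lt_iff₀ hN0] at h1
  · obtain ⟨D, rfl⟩ : ∃ D, n = m + (m + 1 + D) := ⟨n - (2 * m + 1), by omega⟩
    have hD : 1 ≤ D := by omega
    have hD0 : (0 : ℝ) < D := by exact_mod_cast hD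
    have hm0 : (0 : ℝ) ≤ m := Nat.cast_nonneg m
    obtain ⟨x, hx0, hx, huniq, hneg⟩ := exists_unique_root (m := m) hD hδ
    refine ⟨x, ⟨hx0, hx, huniq⟩, fun hle => ?_⟩
    have hle' : (1 - x) * (1 + deltaRatio k ξ) ≤ D := by
      push_cast at hle
      linarith
    refine uniformSimultaneousExponent_le one_pos fun lam h1 _ => ?_
    have hf := hneg lam h1
    set e : ℝ := 1 + deltaRatio k ξ with he
    set u : ℝ := 1 - (m + 1) * lam with hu
    have he0 : 0 < e := by linarith
    have hlam : 0 < lam := hx0.trans h1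
    refine not_uniform_approximation hξ hk hδ hkm hD rfl ?_ (Or.inr ?_)
    -- If `lam (n-m) ≤ 1`, the lower bound on `n` would make the quadratic expression nonnegative at
    -- `lam`, contradicting its sign beyond the root.
    · by_contra hN
      have h2 : D * lam ≤ u := by rw [hu]; linarith
      have h3 : (1 - lam) * e ≤ D :=
        (mul_le_mul_of_nonneg_right (by linarith) he0.le).trans hle'
      have h4 : lam * e * (D - u) ≤ lam * e * (D * (1 - lam)) := by
        gcongr
        linarith
      have h5 := mul_le_mul_of_nonneg_left h3 (by positivity : 0 ≤ lam * D)
      have h6 := mul_le_mul_of_nonneg_left h2 hD0.le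
      linarith
    · rw [← he, ← mul_div_assoc, div_lt_iff₀ he0]
      linarith
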